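/- Let $s\ge 2$ be an integer. A partition of $n$ is called $s$-regular if none of its parts is divisible by $s$; let $b_s(n)$ denote the number of $s$-regular partitions of $n$. Then the sequence $b_s(n)$ is Benford, that is: for every integer base $k\ge 2$ and every positive integer $d$ (regarded as the string of its base-$k$ digits), $$\lim_{x\to\infty}\frac{\#\{1\le n\le x : \text{the base-}k\text{ expansion of } b_s(n) \text{ begins with the digit string of } d\}}{x}=\log_k(d+1)-\log_k(d).$$ -/

import Mathlib

/-- The base-`k` expansion of `m` begins with the digit string which is the base-`k` expansion
of `d`. As `Nat.digits` lists the least significant digit first, the leading digits of `m`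
are the end of the list. -/
def BeginsWith (k d m : ℕ) : Prop :=
  Nat.digits k d <:+ Nat.digits k m

instance (k d m : ℕ) : Decidable (BeginsWith k d m) :=
  inferInstanceAs (Decidable (Nat.digits k d <:+ Nat.digits k m))

/-- The proportion `B(d, x, k; a(n))` of the positive integers `n ≤ x` for which the first digits
of `a n` in base `k` are the string `d`. -/
noncomputable def leadingProportion (a : ℕ → ℕ) (k d : ℕ) (x : ℝ) : ℝ :=
  (((Finset.Icc 1 ⌊x⌋₊).filter (fun n => BeginsWith k d (a n))).card : ℝ) / x

/-- A sequence is Benford if in every base `k ≥ 2` every initial string of digits `d` (a positive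
integer written in base `k`) occurs with limiting frequency `log_k (d + 1) - log_k d`. -/
def IsBenford (a : ℕ → ℕ) : Prop :=
  ∀ k : ℕ, 2 ≤ k → ∀ d : ℕ, 1 ≤ d →
    Filter.Tendsto (fun x : ℝ => leadingProportion a k d x) Filter.atTop
      (nhds (Real.logb (k : ℝ) ((d : ℝ) + 1) - Real.logb (k : ℝ) (d : ℝ)))

/-- The number `b_s(n)` of `s`-regular partitions of `n`: those with no part divisible by `s`. -/
def regularPartitionCount (s n : ℕ) : ℕ :=
  (Nat.Partition.restricted n (fun i => ¬ s ∣ i)).card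

/-!
Taking logarithms to the base `k`, an initial string of digits of `b_s(n)` is a condition on the
fractional part of `log_k b_s(n)` (`beginsWith_iff_fract_lt`), so the claim is that this sequence is
uniformly distributed modulo one. No asymptotic formula for `b_s(n)` is needed for that: it is enough
that `√n (log b_s(n + 1) - log b_s(n))` tends to a positive constant.

*Equidistribution* (`tendsto_count_fract_lt`). If `√n (w (n + 1) - w n) → γ > 0`, compare the
indicator of `fract (w n) < lam`, minus its mean `lam`, with `√n / γ` times the increment of a bounded
periodic primitive (`sawtooth`) along `w`. The two differ by `o(1)` except where `w` crosses an integer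
or a translate of `lam`, which happens `O(w n) = o(n)` times, and the weighted increments sum to
`O(√n)` by summation by parts.

*Increments* (`tendsto_sqrt_mul_log_regularPartitionCount`). For `t > 0` give every `s`-regular
partition of every `n` a probability proportional to `e^{-t n}`; then `b_s(n) e^{-t n}` is proportional
to the probability that the size equals `n`. The logarithm of the generating function is a double
series with nonnegative coefficients (`hasSum_regularPartitionCount`), whose moments give the mean, of
exact order `C / t²` (`tendsto_sq_mul_moment_one`), and the variance `σ²`, of order `t⁻³`. Choose `t`
such that the mean is `n`; then `√n t → √C`. The third moment controls the characteristic function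
near zero, and `exists_le_logGap` controls it elsewhere by means of the parts congruent to `1` modulo
`s`. Hence there is a local limit theorem: the probability of `n` is of order `σ⁻¹`
(`tendsto_tiltedStd_mul_tiltedCoeff`), while the probabilities of `n` and `n + 1` differ by `O(σ⁻²)`
(`exists_norm_tiltedCoeff_succ_sub_le`). So `log b_s(n + 1) - log b_s(n) = t + O(σ⁻¹)
= t + O(t^{3/2})`.
-/

open Filter Topology

/-! ### Equidistribution modulo one from the increments -/

/-- The periodic primitive of `1_{fract y < lam} - lam` which vanishes at the integers. -/
noncomputable def sawtooth (lam y : ℝ) : ℝ := min (Int.fract y) lam - lam * Int.fract y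

lemma sawtooth_nonneg {lam : ℝ} (h0 : 0 ≤ lam) (h1 : lam ≤ 1) (y : ℝ) : 0 ≤ sawtooth lam y := by
  have := Int.fract_nonneg y
  have := (Int.fract_lt_one y).le
  unfold sawtooth
  rcases min_cases (Int.fract y) lam with h | h <;> rw [h.1] <;> nlinarith

lemma sawtooth_le_one {lam : ℝ} (h0 : 0 ≤ lam) (h1 : lam ≤ 1) (y : ℝ) : sawtooth lam y ≤ 1 := by
  have := Int.fract_nonneg y
  have := min_le_right (Int.fract y) lam
  unfold sawtooth
  nlinarith

lemma sawtooth_eq (lam y : ℝ) (j : ℤ) (h0 : (j : ℝ) ≤ y) (h1 : y ≤ j + 1) (hl0 : 0 ≤ lam)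
    (hl1 : lam ≤ 1) :
    sawtooth lam y = min (y - j) lam - lam * (y - j) := by
  rcases h1.lt_or_eq with h | h
  · have : ⌊y⌋ = j := Int.floor_eq_iff.2 ⟨h0, h⟩
    simp [sawtooth, Int.fract, this]
  · have : ⌊y⌋ = j + 1 := Int.floor_eq_iff.2 ⟨by push_cast; linarith, by push_cast; linarith⟩
    subst h
    have e : Int.fract ((j : ℝ) + 1) = 0 := by
      rw [Int.fract, this]; push_cast; ring
    simp [sawtooth, e, hl0, hl1]

/-- As long as `(y, y']` meets no integer and no integer translate of `lam`, the increment of the sawtooth is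
the indicator minus its mean, times the step, so that with `c` close to the inverse of the step the
left-hand side is small. The number of crossings is bounded by the increment of `⌊y⌋ + ⌊y - lam⌋`,
which telescopes along a sequence. -/
lemma abs_indicator_sub_sawtooth_le {lam c y y' : ℝ} (hl0 : 0 < lam) (hl1 : lam ≤ 1) (hc : 0 ≤ c)
    (hy : y ≤ y') (hs : c * (y' - y) ≤ 2) (hs' : y' - y ≤ 1) :
    |(if Int.fract y < lam then 1 else 0) - lam - c * (sawtooth lam y' - sawtooth lam y)| ≤
      |1 - c * (y' - y)| + 3 * ((⌊y'⌋ + ⌊y' - lam⌋ : ℤ) - (⌊y⌋ + ⌊y - lam⌋ : ℤ)) := by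
  have m1 : ⌊y⌋ ≤ ⌊y'⌋ := Int.floor_le_floor hy
  have m2 : ⌊y - lam⌋ ≤ ⌊y' - lam⌋ := Int.floor_le_floor (by linarith)
  have f0 := Int.floor_le y
  have f1 := Int.lt_floor_add_one y
  have hfr : Int.fract y = y - ⌊y⌋ := rfl
  by_cases hj : ⌊y'⌋ + ⌊y' - lam⌋ = ⌊y⌋ + ⌊y - lam⌋
  · have e1 : ⌊y'⌋ = ⌊y⌋ := by omega
    have e2 : ⌊y' - lam⌋ = ⌊y - lam⌋ := by omega
    rw [hj]
    simp only [sub_self, mul_zero, add_zero]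
    have g0 := Int.floor_le y'
    have g1 := Int.lt_floor_add_one y'
    rw [e1] at g0 g1
    rw [sawtooth_eq lam y ⌊y⌋ f0 f1.le hl0.le hl1, sawtooth_eq lam y' ⌊y⌋ g0 g1.le hl0.le hl1, hfr]
    split_ifs with hf
    · have e3 : ⌊y - lam⌋ = ⌊y⌋ - 1 :=
        Int.floor_eq_iff.2 ⟨by push_cast; linarith, by push_cast; linarith⟩
      have g2 := Int.lt_floor_add_one (y' - lam)
      rw [e2, e3] at g2
      push_cast at g2
      rw [min_eq_left (by linarith), min_eq_left (by linarith)]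
      rw [show (1 : ℝ) - lam - c * (y' - ⌊y⌋ - lam * (y' - ⌊y⌋) - (y - ⌊y⌋ - lam * (y - ⌊y⌋)))
        = (1 - lam) * (1 - c * (y' - y)) by ring, abs_mul, abs_of_nonneg (by linarith : 0 ≤ 1 - lam)]
      exact mul_le_of_le_one_left (abs_nonneg _) (by linarith)
    · push Not at hf
      rw [min_eq_right (by linarith), min_eq_right (by linarith)]
      rw [show (0 : ℝ) - lam - c * (lam - lam * (y' - ⌊y⌋) - (lam - lam * (y - ⌊y⌋)))
        = (-lam) * (1 - c * (y' - y)) by ring, abs_mul, abs_neg, abs_of_pos hl0]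
      exact mul_le_of_le_one_left (abs_nonneg _) hl1
  · have h1 : (1 : ℝ) ≤ ((⌊y'⌋ + ⌊y' - lam⌋ : ℤ) : ℝ) - (⌊y⌋ + ⌊y - lam⌋ : ℤ) := by
      rw [← Int.cast_sub]; exact_mod_cast (by omega : 1 ≤ ⌊y'⌋ + ⌊y' - lam⌋ - (⌊y⌋ + ⌊y - lam⌋))
    -- across a jump only the Lipschitz bound for the sawtooth is left
    have hlip : |sawtooth lam y' - sawtooth lam y| ≤ y' - y := by
      rcases lt_or_ge y' (⌊y⌋ + 1 : ℝ) with h | h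
      · rw [sawtooth_eq lam y ⌊y⌋ f0 f1.le hl0.le hl1,
          sawtooth_eq lam y' ⌊y⌋ (by linarith) h.le hl0.le hl1, abs_le]
        rcases min_cases (y - ⌊y⌋) lam with h1 | h1 <;>
        rcases min_cases (y' - ⌊y⌋) lam with h2 | h2 <;> rw [h1.1, h2.1] <;>
        constructor <;> nlinarith
      · rw [sawtooth_eq lam y ⌊y⌋ f0 f1.le hl0.le hl1,
          sawtooth_eq lam y' (⌊y⌋ + 1) (by push_cast; linarith) (by push_cast; linarith) hl0.le hl1,
          abs_le]
        push_cast
        rcases min_cases (y - ⌊y⌋) lam with h1 | h1 <;>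
        rcases min_cases (y' - (⌊y⌋ + 1)) lam with h2 | h2 <;> rw [h1.1, h2.1] <;>
        constructor <;> nlinarith
    have h2 : |(if Int.fract y < lam then (1 : ℝ) else 0) - lam| ≤ 1 := by
      split_ifs <;> rw [abs_le] <;> constructor <;> linarith
    have h3 : |c * (sawtooth lam y' - sawtooth lam y)| ≤ 2 := by
      rw [abs_mul, abs_of_nonneg hc]
      exact (mul_le_mul_of_nonneg_left hlip hc).trans hs
    have := abs_sub (if Int.fract y < lam then (1 : ℝ) else 0) (lam : ℝ)
    have := abs_sub ((if Int.fract y < lam then (1 : ℝ) else 0) - lam)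
      (c * (sawtooth lam y' - sawtooth lam y))
    have := abs_nonneg (1 - c * (y' - y))
    linarith

/-- Summation by parts against `√n` costs at most `√N` when the summands are increments of a
sequence in `[0, 1]`. -/
lemma abs_sum_sqrt_mul_increment_le (u : ℕ → ℝ) (h0 : ∀ n, 0 ≤ u n) (h1 : ∀ n, u n ≤ 1) (N : ℕ) :
    |∑ n ∈ Finset.range N, √n * (u (n + 1) - u n)| ≤ 2 * √N := by
  have key : |∑ n ∈ Finset.range N, √n * (u (n + 1) - u n) - √N * u N| ≤ √N := by
    induction N with
    | zero => simp
    | succ N ih =>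
      have hm : √(N : ℝ) ≤ √((N + 1 : ℕ) : ℝ) := Real.sqrt_le_sqrt (by push_cast; linarith)
      rw [Finset.sum_range_succ]
      rw [abs_le] at ih ⊢
      have a := h0 (N + 1)
      have b := h1 (N + 1)
      constructor <;> nlinarith
  have : √(N : ℝ) * u N ≤ √N := mul_le_of_le_one_right (Real.sqrt_nonneg _) (h1 N)
  have : 0 ≤ √(N : ℝ) * u N := mul_nonneg (Real.sqrt_nonneg _) (h0 N)
  rw [abs_le] at key ⊢
  constructor <;> linarith

lemma tendsto_div_of_tendsto_increment_zero {w : ℕ → ℝ}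
    (h : Tendsto (fun n => w (n + 1) - w n) atTop (𝓝 0)) :
    Tendsto (fun n : ℕ => w n / n) atTop (𝓝 0) := by
  have h1 := h.cesaro
  have h2 : Tendsto (fun n : ℕ => (n : ℝ)⁻¹ * w 0) atTop (𝓝 0) := by
    simpa using tendsto_inv_atTop_nhds_zero_nat.mul_const (w 0)
  have := h1.add h2
  rw [add_zero] at this
  refine this.congr fun n => ?_
  rw [Finset.sum_range_sub]
  ring

/-- **Fejér-type equidistribution**: if the increments of `w` are asymptotic to `γ / √n`, then `w`
is uniformly distributed modulo one. -/
theorem tendsto_count_fract_lt {w : ℕ → ℝ} {γ lam : ℝ} (hγ : 0 < γ) (hl0 : 0 < lam) (hl1 : lam ≤ 1)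
    (hw : Tendsto (fun n : ℕ => √n * (w (n + 1) - w n)) atTop (𝓝 γ)) :
    Tendsto (fun N : ℕ => (∑ n ∈ Finset.range N, if Int.fract (w n) < lam then (1 : ℝ) else 0) / N)
      atTop (𝓝 lam) := by
  have hsq : Tendsto (fun n : ℕ => √(n : ℝ)) atTop atTop :=
    Real.tendsto_sqrt_atTop.comp tendsto_natCast_atTop_atTop
  have hsqi : Tendsto (fun n : ℕ => (√(n : ℝ))⁻¹) atTop (𝓝 0) := tendsto_inv_atTop_zero.comp hsq
  have hd : Tendsto (fun n => w (n + 1) - w n) atTop (𝓝 0) := by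
    have := hsqi.mul hw
    rw [zero_mul] at this
    refine this.congr' ?_
    filter_upwards [eventually_gt_atTop 0] with n hn
    have : √(n : ℝ) ≠ 0 := by positivity
    field_simp
  set Jf : ℕ → ℝ := fun n => ((⌊w n⌋ + ⌊w n - lam⌋ : ℤ) : ℝ) with hJf
  set f : ℕ → ℝ := fun n => if Int.fract (w n) < lam then (1 : ℝ) else 0 with hf
  set e : ℕ → ℝ := fun n => |1 - √n / γ * (w (n + 1) - w n)| with he
  set g : ℕ → ℝ := fun n =>
    f n - lam - √n / γ * (sawtooth lam (w (n + 1)) - sawtooth lam (w n)) with hg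
  have he0 : Tendsto e atTop (𝓝 0) := by
    have : Tendsto (fun n : ℕ => |1 - (√n * (w (n + 1) - w n)) / γ|) atTop (𝓝 |1 - γ / γ|) :=
      (tendsto_const_nhds.sub (hw.div_const γ)).abs
    rw [div_self hγ.ne', sub_self, abs_zero] at this
    refine this.congr fun n => ?_
    simp only [he]
    congr 2
    ring
  have hpt : ∀ᶠ n in atTop, |g n| ≤ e n + 3 * (Jf (n + 1) - Jf n) := by
    filter_upwards [hw.eventually (lt_mem_nhds hγ), hw.eventually (gt_mem_nhds (by linarith : γ < 2 * γ)),
      hd.eventually (gt_mem_nhds one_pos), eventually_gt_atTop 0] with n h1 h2 h3 h4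
    have hp : 0 < √(n : ℝ) := by positivity
    have h5 : 0 < w (n + 1) - w n := by
      by_contra h
      push Not at h
      nlinarith
    refine abs_indicator_sub_sawtooth_le hl0 hl1 (by positivity) (by linarith) ?_ h3.le
    rw [div_mul_eq_mul_div, div_le_iff₀ hγ]
    exact h2.le
  have hJ0 : Tendsto (fun N : ℕ => Jf N / N) atTop (𝓝 0) := by
    have hwn := tendsto_div_of_tendsto_increment_zero hd
    have hn := tendsto_inv_atTop_nhds_zero_nat (𝕜 := ℝ)
    have lo : Tendsto (fun N : ℕ => 2 * (w N / N) - 4 * (N : ℝ)⁻¹) atTop (𝓝 0) := by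
      simpa using (hwn.const_mul 2).sub (hn.const_mul 4)
    have hi : Tendsto (fun N : ℕ => 2 * (w N / N)) atTop (𝓝 0) := by
      simpa using (hwn.const_mul 2)
    refine tendsto_of_tendsto_of_tendsto_of_le_of_le' lo hi ?_ ?_
    · filter_upwards [eventually_gt_atTop 0] with N hN
      have hN' : (0 : ℝ) < N := by exact_mod_cast hN
      have := Int.lt_floor_add_one (w N)
      have := Int.lt_floor_add_one (w N - lam)
      rw [show 2 * (w N / N) - 4 * (N : ℝ)⁻¹ = (2 * w N - 4) / N by ring]
      refine div_le_div_of_nonneg_right ?_ hN'.le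
      simp only [hJf]; push_cast; linarith
    · filter_upwards [eventually_gt_atTop 0] with N hN
      have hN' : (0 : ℝ) < N := by exact_mod_cast hN
      have := Int.floor_le (w N)
      have := Int.floor_le (w N - lam)
      rw [show 2 * (w N / N) = (2 * w N) / N by ring]
      refine div_le_div_of_nonneg_right ?_ hN'.le
      simp only [hJf]; push_cast; linarith
  have hgavg : Tendsto (fun N : ℕ => (∑ n ∈ Finset.range N, g n) / N) atTop (𝓝 0) := by
    obtain ⟨n0, hn0⟩ := eventually_atTop.1 hpt
    -- the constant `A` absorbs the initial segment
    obtain ⟨A, hA⟩ : ∃ A : ℝ, ∀ N ≥ n0, |∑ n ∈ Finset.range N, g n| ≤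
        A + ∑ n ∈ Finset.range N, e n + 3 * Jf N := by
      refine ⟨|∑ n ∈ Finset.range n0, g n| - ∑ n ∈ Finset.range n0, e n - 3 * Jf n0, ?_⟩
      intro N hN
      induction N, hN using Nat.le_induction with
      | base => linarith
      | succ N hN ih =>
        rw [Finset.sum_range_succ, Finset.sum_range_succ]
        have := hn0 N hN
        have := abs_add_le (∑ n ∈ Finset.range N, g n) (g N)
        linarith
    have hb : Tendsto (fun N : ℕ => A * (N : ℝ)⁻¹ + (N : ℝ)⁻¹ * ∑ n ∈ Finset.range N, e n
        + 3 * (Jf N / N)) atTop (𝓝 0) := by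
      simpa using ((tendsto_inv_atTop_nhds_zero_nat (𝕜 := ℝ)).const_mul A).add he0.cesaro |>.add
        (hJ0.const_mul 3)
    refine squeeze_zero_norm' ?_ hb
    filter_upwards [eventually_ge_atTop n0, eventually_gt_atTop 0] with N hN hN0
    have hN' : (0 : ℝ) < N := by exact_mod_cast hN0
    rw [Real.norm_eq_abs, abs_div, abs_of_pos hN', div_le_iff₀ hN']
    refine (hA N hN).trans (le_of_eq ?_)
    field_simp
  have hsaw : Tendsto (fun N : ℕ => (∑ n ∈ Finset.range N,
      √n / γ * (sawtooth lam (w (n + 1)) - sawtooth lam (w n))) / N) atTop (𝓝 0) := by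
    have hb : Tendsto (fun N : ℕ => 2 / γ * (√(N : ℝ))⁻¹) atTop (𝓝 0) := by
      simpa using hsqi.const_mul (2 / γ)
    refine squeeze_zero_norm' ?_ hb
    filter_upwards [eventually_gt_atTop 0] with N hN0
    have hN' : (0 : ℝ) < N := by exact_mod_cast hN0
    have := abs_sum_sqrt_mul_increment_le (fun n => sawtooth lam (w n))
      (fun n => sawtooth_nonneg hl0.le hl1 _) (fun n => sawtooth_le_one hl0.le hl1 _) N
    simp_rw [div_mul_eq_mul_div]
    rw [← Finset.sum_div, Real.norm_eq_abs, abs_div, abs_div, abs_of_pos hN', abs_of_pos hγ,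
      div_le_iff₀ hN', div_le_iff₀ hγ]
    refine this.trans (le_of_eq ?_)
    have hp : 0 < √(N : ℝ) := by positivity
    have h2 : √(N : ℝ) ^ 2 = N := Real.sq_sqrt hN'.le
    field_simp
    exact h2
  have := (hgavg.add hsaw).add_const lam
  rw [add_zero, zero_add] at this
  refine this.congr' ?_
  filter_upwards [eventually_gt_atTop 0] with N hN0
  have hN' : (0 : ℝ) < N := by exact_mod_cast hN0
  simp only [hg, Finset.sum_sub_distrib, Finset.sum_const, Finset.card_range, nsmul_eq_mul]
  field_simp
  ring

/-! ### Leading digits -/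

lemma beginsWith_iff_exists_div_pow_eq {k d m : ℕ} (hk : 2 ≤ k) (hd : 1 ≤ d) :
    BeginsWith k d m ↔ ∃ j, m / k ^ j = d := by
  constructor
  · intro h
    refine ⟨(Nat.digits k m).length - (Nat.digits k d).length, ?_⟩
    rw [Nat.self_div_pow_eq_ofDigits_drop _ _ hk, ← List.suffix_iff_eq_drop.1 h, Nat.ofDigits_digits]
  · rintro ⟨j, rfl⟩
    have hne : (Nat.digits k m).drop j ≠ [] := by
      intro h
      rw [Nat.self_div_pow_eq_ofDigits_drop _ _ hk, h] at hd
      simp at hd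
    unfold BeginsWith
    rw [Nat.self_div_pow_eq_ofDigits_drop _ _ hk, Nat.digits_ofDigits k (by omega)]
    · exact List.drop_suffix _ _
    · exact fun l hl => Nat.digits_lt_base (by omega) (List.mem_of_mem_drop hl)
    · intro h
      rw [List.getLast_drop]
      apply Nat.getLast_digit_ne_zero
      rintro rfl
      simp at hd

lemma fract_lt_iff_exists_int {x lam : ℝ} (h1 : lam ≤ 1) :
    Int.fract x < lam ↔ ∃ i : ℤ, (i : ℝ) ≤ x ∧ x < i + lam := by
  constructor
  · intro h
    refine ⟨⌊x⌋, Int.floor_le x, ?_⟩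
    have := Int.floor_add_fract x
    linarith
  · rintro ⟨i, h2, h3⟩
    have : ⌊x⌋ = i := Int.floor_eq_iff.2 ⟨h2, by linarith⟩
    rw [Int.fract, this]
    linarith

lemma logb_succ_sub_logb_le_one {k d : ℕ} (hk : 2 ≤ k) (hd : 1 ≤ d) :
    Real.logb k (d + 1) - Real.logb k d ≤ 1 := by
  have hk2 : (2 : ℝ) ≤ k := by exact_mod_cast hk
  have hd1 : (1 : ℝ) ≤ d := by exact_mod_cast hd
  have hk1 : (1 : ℝ) < k := by linarith
  have h1 : Real.logb k (k * d) = 1 + Real.logb k d := by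
    rw [Real.logb_mul (by positivity) (by positivity), Real.logb_self_eq_one hk1]
  rw [sub_le_iff_le_add, ← h1]
  refine (Real.logb_le_logb hk1 (by positivity) (by positivity)).2 ?_
  nlinarith

/-- The leading digits of `m` are read off the fractional part of `log_k m - log_k d`. -/
lemma beginsWith_iff_fract_lt {k d m : ℕ} (hk : 2 ≤ k) (hd : 1 ≤ d) (hm : d ≤ m) :
    BeginsWith k d m ↔ Int.fract (Real.logb k m - Real.logb k d) <
      Real.logb k (d + 1) - Real.logb k d := by
  have hk1 : (1 : ℝ) < k := by exact_mod_cast (by omega : 1 < k)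
  have hk0 : (0 : ℝ) < k := by linarith
  have hd0 : (0 : ℝ) < d := by exact_mod_cast hd
  have hm0 : (0 : ℝ) < m := by exact_mod_cast (by omega : 0 < m)
  have hl1 := logb_succ_sub_logb_le_one hk hd
  rw [beginsWith_iff_exists_div_pow_eq hk hd, fract_lt_iff_exists_int hl1]
  have key : ∀ j : ℕ, m / k ^ j = d ↔ ((j : ℤ) : ℝ) ≤ Real.logb k m - Real.logb k d ∧
      Real.logb k m - Real.logb k d < (j : ℤ) + (Real.logb k (d + 1) - Real.logb k d) := by
    intro j
    have hpos : 0 < k ^ j := by positivity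
    have e1 : ∀ x : ℝ, 0 < x → Real.logb k (x * k ^ j) = Real.logb k x + j := by
      intro x hx
      rw [Real.logb_mul hx.ne' (by positivity), Real.logb_pow, Real.logb_self_eq_one hk1, mul_one]
    have e2 : d * k ^ j ≤ m ↔ Real.logb k d + j ≤ Real.logb k m := by
      rw [← e1 d hd0, Real.logb_le_logb hk1 (by positivity) hm0]
      exact_mod_cast Iff.rfl
    have e3 : m < (d + 1) * k ^ j ↔ Real.logb k m < Real.logb k (d + 1) + j := by
      rw [← e1 (d + 1) (by positivity), ← not_le, ← not_le,
        Real.logb_le_logb hk1 (by positivity) hm0]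
      exact_mod_cast Iff.rfl
    have e4 : m / k ^ j = d ↔ d * k ^ j ≤ m ∧ m < (d + 1) * k ^ j := by
      rw [← Nat.le_div_iff_mul_le hpos, ← Nat.div_lt_iff_lt_mul hpos]
      omega
    rw [e4, e2, e3]
    push_cast
    constructor <;> rintro ⟨h1, h2⟩ <;> constructor <;> linarith
  constructor
  · rintro ⟨j, hj⟩
    exact ⟨j, (key j).1 hj⟩
  · rintro ⟨i, h1, h2⟩
    -- as `d ≤ m`, the number of remaining digits is not negative
    have h3 : 0 ≤ Real.logb k m - Real.logb k d :=
      sub_nonneg.2 ((Real.logb_le_logb hk1 hd0 hm0).2 (by exact_mod_cast hm))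
    have h4 : 0 ≤ i := by
      by_contra h
      have : ((i + 1 : ℤ) : ℝ) ≤ 0 := by exact_mod_cast (by omega : i + 1 ≤ 0)
      push_cast at this
      linarith
    lift i to ℕ using h4
    exact ⟨i, (key i).2 ⟨h1, h2⟩⟩

/-- A sequence whose increments are asymptotic to a positive multiple of `1 / √n` is unbounded. -/
lemma tendsto_atTop_of_sqrt_mul_increment {w : ℕ → ℝ} {γ : ℝ} (hγ : 0 < γ)
    (hw : Tendsto (fun n : ℕ => √n * (w (n + 1) - w n)) atTop (𝓝 γ)) :
    Tendsto w atTop atTop := by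
  obtain ⟨n0, hn0⟩ := eventually_atTop.1 (hw.eventually (lt_mem_nhds (half_lt_self hγ)))
  have hsq : Tendsto (fun n : ℕ => √(n : ℝ)) atTop atTop :=
    Real.tendsto_sqrt_atTop.comp tendsto_natCast_atTop_atTop
  have hlow : ∀ n ≥ n0, w n0 - γ / 2 * √n0 + γ / 2 * √n ≤ w n := by
    intro n hn
    induction n, hn using Nat.le_induction with
    | base => linarith
    | succ n hn ih =>
      have h := hn0 n hn
      have hp : 0 < √(n : ℝ) := by
        rcases (Real.sqrt_nonneg (n : ℝ)).lt_or_eq with h' | h'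
        · exact h'
        · rw [← h', zero_mul] at h
          linarith
      have hs : √((n + 1 : ℕ) : ℝ) * √n ≤ n + 1 := by
        have h1 : √(n : ℝ) ≤ √((n + 1 : ℕ) : ℝ) := Real.sqrt_le_sqrt (by push_cast; linarith)
        have h2 : √((n + 1 : ℕ) : ℝ) * √((n + 1 : ℕ) : ℝ) = n + 1 := by
          rw [Real.mul_self_sqrt (by positivity)]; push_cast; ring
        nlinarith [Real.sqrt_nonneg ((n + 1 : ℕ) : ℝ)]
      have h2 : √(n : ℝ) * √n = n := Real.mul_self_sqrt (by positivity)
      have h3 : √(n : ℝ) * (γ / 2 * (√((n + 1 : ℕ) : ℝ) - √n)) ≤ √n * (w (n + 1) - w n) := by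
        refine le_trans ?_ h.le
        nlinarith
      have h4 := le_of_mul_le_mul_left h3 hp
      linarith
  refine tendsto_atTop_mono' atTop (eventually_atTop.2 ⟨n0, hlow⟩) ?_
  exact tendsto_atTop_add_const_left _ _ (hsq.const_mul_atTop (half_pos hγ))

/-- Benford's law for a sequence whose logarithm grows like a positive multiple of `√n`, in the
sense of its increments. -/
theorem isBenford_of_sqrt_mul_log_increment {a : ℕ → ℕ} {γ : ℝ} (hγ : 0 < γ)
    (ha : Tendsto (fun n : ℕ => √n * (Real.log (a (n + 1)) - Real.log (a n))) atTop (𝓝 γ)) :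
    IsBenford a := by
  intro k hk d hd
  have hk1 : (1 : ℝ) < k := by exact_mod_cast (by omega : 1 < k)
  have hlk : 0 < Real.log k := Real.log_pos hk1
  have hd0 : (0 : ℝ) < d := by exact_mod_cast hd
  set lam := Real.logb k (d + 1) - Real.logb k d with hlam
  have hl0 : 0 < lam := sub_pos.2 (Real.logb_lt_logb hk1 hd0 (by linarith))
  have hl1 : lam ≤ 1 := logb_succ_sub_logb_le_one hk hd
  set w : ℕ → ℝ := fun n => Real.logb k (a n) - Real.logb k d with hw
  have hwlim : Tendsto (fun n : ℕ => √n * (w (n + 1) - w n)) atTop (𝓝 (γ / Real.log k)) := by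
    refine (ha.div_const (Real.log k)).congr fun n => ?_
    simp only [hw, Real.logb]
    ring
  have hcount := tendsto_count_fract_lt (div_pos hγ hlk) hl0 hl1 hwlim
  have hbig : ∀ᶠ n in atTop, d ≤ a n := by
    have hlog := tendsto_atTop_of_sqrt_mul_increment (w := fun n => Real.log (a n)) hγ ha
    filter_upwards [hlog.eventually_gt_atTop (Real.log d), hlog.eventually_gt_atTop 0] with n hn hn'
    have hpos : (0 : ℝ) < a n := by
      rcases Nat.eq_zero_or_pos (a n) with h | h
      · simp [h] at hn'
      · exact_mod_cast h
    exact_mod_cast ((Real.log_lt_log_iff hd0 hpos).1 hn).le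
  set g : ℕ → ℝ := fun n => if BeginsWith k d (a n) then (1 : ℝ) else 0 with hg
  have hgcount : Tendsto (fun N : ℕ => (∑ n ∈ Finset.range N, g n) / N) atTop (𝓝 lam) := by
    have hdiff : Tendsto (fun n => g n - if Int.fract (w n) < lam then (1 : ℝ) else 0) atTop
        (𝓝 0) := by
      refine tendsto_const_nhds.congr' ?_
      filter_upwards [hbig] with n hn
      simp only [hg, beginsWith_iff_fract_lt hk hd hn, hw, hlam, sub_self]
    have := hdiff.cesaro.add hcount
    rw [zero_add] at this
    refine this.congr fun N => ?_
    rw [Finset.sum_sub_distrib]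
    ring
  have hfl : Tendsto (fun x : ℝ => ⌊x⌋₊ + 1) atTop atTop :=
    (tendsto_add_atTop_nat 1).comp tendsto_nat_floor_atTop
  have hratio : Tendsto (fun x : ℝ => ((⌊x⌋₊ + 1 : ℕ) : ℝ) / x) atTop (𝓝 1) := by
    have := (tendsto_nat_floor_div_atTop (R := ℝ)).add tendsto_inv_atTop_zero
    rw [add_zero] at this
    refine this.congr fun x => ?_
    push_cast
    ring
  have h0 : Tendsto (fun x : ℝ => g 0 * x⁻¹) atTop (𝓝 0) := by
    simpa using tendsto_inv_atTop_zero.const_mul (g 0)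
  have := ((hgcount.comp hfl).mul hratio).sub h0
  rw [mul_one, sub_zero] at this
  refine this.congr fun x => ?_
  have hcard : (((Finset.Icc 1 ⌊x⌋₊).filter (fun n => BeginsWith k d (a n))).card : ℝ) =
      ∑ n ∈ Finset.range (⌊x⌋₊ + 1), g n - g 0 := by
    rw [← Finset.sum_boole, Finset.range_eq_Ico, Finset.sum_eq_sum_Ico_succ_bot (by omega)]
    simp only [hg]
    rw [add_sub_cancel_left]
    exact Finset.sum_congr (by ext; simp) fun _ _ => rfl
  simp only [leadingProportion, hcard, Function.comp]
  have : ((⌊x⌋₊ + 1 : ℕ) : ℝ) ≠ 0 := by positivity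
  field_simp

/-! ### The generating function of regular partitions -/

lemma HasSum.congr_of_eq {α β : Type*} [AddCommMonoid α] [TopologicalSpace α] {f g : β → α} {a : α}
    (hf : HasSum f a) (h : ∀ b, g b = f b) : HasSum g a := by
  rwa [funext h]

/-- The coefficient of `e^{-N z}`, `N = (i + 1) (j + 1)`, which the factor `(1 - e^{-(i + 1) z})⁻¹`
contributes to the logarithm of the generating function of `s`-regular partitions. -/
noncomputable def logWeight (s : ℕ) (p : ℕ × ℕ) : ℝ := if s ∣ p.1 + 1 then 0 else 1 / (p.2 + 1)

/-- The exponent which belongs to `logWeight s p`. -/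
def logExponent (p : ℕ × ℕ) : ℕ := (p.1 + 1) * (p.2 + 1)

/-- The logarithm of the generating function of `s`-regular partitions at `e^{-z}`, expanded as a
double series in the parts and the powers in the logarithmic series. -/
noncomputable def logGen (s : ℕ) (z : ℂ) : ℂ :=
  ∑' p, (logWeight s p : ℂ) * Complex.exp (-(logExponent p * z))

lemma logWeight_nonneg (s : ℕ) (p : ℕ × ℕ) : 0 ≤ logWeight s p := by
  unfold logWeight
  split_ifs <;> positivity

lemma logWeight_le_one (s : ℕ) (p : ℕ × ℕ) : logWeight s p ≤ 1 := by
  unfold logWeight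
  split_ifs
  · exact zero_le_one
  · rw [div_le_one (by positivity)]
    linarith [(Nat.cast_nonneg p.2 : (0 : ℝ) ≤ p.2)]

/-- A power is absorbed by half of the exponential decay. -/
lemma pow_mul_exp_neg_le {x t : ℝ} (hx : 0 ≤ x) (ht : 0 < t) (j : ℕ) :
    x ^ j * Real.exp (-(x * t)) ≤ j.factorial * 2 ^ j / t ^ j * Real.exp (-(x * (t / 2))) := by
  have h := Real.pow_div_factorial_le_exp (x := x * (t / 2)) (by positivity) j
  have hf : (0 : ℝ) < j.factorial := by exact_mod_cast j.factorial_pos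
  rw [div_le_iff₀ hf] at h
  have e : Real.exp (-(x * t)) = Real.exp (-(x * (t / 2))) * Real.exp (-(x * (t / 2))) := by
    rw [← Real.exp_add]; congr 1; ring
  have e2 : Real.exp (x * (t / 2)) * Real.exp (-(x * (t / 2))) = 1 := by
    rw [← Real.exp_add]; simp
  have e3 : x ^ j = 2 ^ j / t ^ j * (x * (t / 2)) ^ j := by
    rw [← div_pow, ← mul_pow]; congr 1; field_simp
  have hE := Real.exp_pos (-(x * (t / 2)))
  calc x ^ j * Real.exp (-(x * t))
      = 2 ^ j / t ^ j * (x * (t / 2)) ^ j * Real.exp (-(x * (t / 2)))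
          * Real.exp (-(x * (t / 2))) := by rw [e, e3]; ring
    _ ≤ 2 ^ j / t ^ j * (Real.exp (x * (t / 2)) * j.factorial) * Real.exp (-(x * (t / 2)))
          * Real.exp (-(x * (t / 2))) := by gcongr
    _ = 2 ^ j / t ^ j * j.factorial * (Real.exp (x * (t / 2)) * Real.exp (-(x * (t / 2))))
          * Real.exp (-(x * (t / 2))) := by ring
    _ = _ := by rw [e2]; ring

lemma summable_exp_neg_mul_nat {t : ℝ} (ht : 0 < t) :
    Summable fun n : ℕ => Real.exp (-(n * t)) := by
  have := summable_geometric_of_lt_one (Real.exp_pos (-t)).le (by simpa using ht)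
  refine this.congr fun n => ?_
  rw [← Real.exp_nat_mul]
  congr 1
  ring

lemma summable_exp_neg_logExponent {t : ℝ} (ht : 0 < t) :
    Summable fun p : ℕ × ℕ => Real.exp (-(logExponent p * t)) := by
  have h := summable_exp_neg_mul_nat ht
  refine Summable.of_nonneg_of_le (fun _ => (Real.exp_pos _).le) (fun p => ?_)
    (h.mul_of_nonneg h (fun _ => (Real.exp_pos _).le) (fun _ => (Real.exp_pos _).le))
  rw [← Real.exp_add, Real.exp_le_exp]
  have : ((p.1 : ℝ) + p.2) * t ≤ logExponent p * t := by
    refine mul_le_mul_of_nonneg_right ?_ ht.le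
    have : p.1 + p.2 ≤ logExponent p := by unfold logExponent; nlinarith
    exact_mod_cast this
  linarith

lemma summable_logWeight_mul {t : ℝ} (ht : 0 < t) (s j : ℕ) :
    Summable fun p => logWeight s p * ((logExponent p : ℝ) ^ j * Real.exp (-(logExponent p * t))) := by
  refine Summable.of_nonneg_of_le (fun p => mul_nonneg (logWeight_nonneg s p) (by positivity))
    (fun p => ?_) ((summable_exp_neg_logExponent (half_pos ht)).mul_left
      (j.factorial * 2 ^ j / t ^ j))
  exact (mul_le_of_le_one_left (by positivity) (logWeight_le_one s p)).trans
    (pow_mul_exp_neg_le (Nat.cast_nonneg _) ht j)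

lemma norm_logGen_term (s : ℕ) (z : ℂ) (p : ℕ × ℕ) :
    ‖(logWeight s p : ℂ) * Complex.exp (-(logExponent p * z))‖ =
      logWeight s p * Real.exp (-(logExponent p * z.re)) := by
  rw [norm_mul, Complex.norm_exp, Complex.norm_real, Real.norm_eq_abs,
    abs_of_nonneg (logWeight_nonneg s p)]
  simp

lemma summable_logGen {z : ℂ} (hz : 0 < z.re) (s : ℕ) :
    Summable fun p => (logWeight s p : ℂ) * Complex.exp (-(logExponent p * z)) := by
  refine Summable.of_norm ((summable_logWeight_mul hz s 0).congr fun p => ?_)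
  rw [norm_logGen_term, pow_zero, one_mul]

section GeneratingFunction

open PowerSeries

/-- The geometric series in `X ^ m`. -/
noncomputable def geomSeries (m : ℕ) : PowerSeries ℕ := PowerSeries.mk fun n => if m ∣ n then 1 else 0

open PowerSeries.WithPiTopology in
lemma tsum_X_pow_eq_geomSeries {m : ℕ} (hm : 0 < m) :
    (∑' j : ℕ, (X : PowerSeries ℕ) ^ (m * j)) = geomSeries m := by
  have : HasSum (fun j : ℕ => (X : PowerSeries ℕ) ^ (m * j)) (geomSeries m) := by
    rw [PowerSeries.WithPiTopology.hasSum_iff_hasSum_coeff]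
    intro d
    simp only [coeff_X_pow, geomSeries, coeff_mk]
    split_ifs with h
    · obtain ⟨c, rfl⟩ := h
      have h1 : ∀ j, j ≠ c → (if m * c = m * j then (1 : ℕ) else 0) = 0 := fun j hj =>
        if_neg fun h => hj (Nat.eq_of_mul_eq_mul_left hm h).symm
      simpa using hasSum_single c h1
    · have h1 : ∀ j, (if d = m * j then (1 : ℕ) else 0) = 0 := fun j =>
        if_neg fun h' => h ⟨j, h'⟩
      simpa only [h1] using hasSum_zero
  exact this.tsum_eq

/-- The partial product of the generating function over the parts `i + 1`, `i ∈ A`. -/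
noncomputable def partialGen (s : ℕ) (A : Finset ℕ) : PowerSeries ℕ :=
  ∏ i ∈ A, if ¬ s ∣ i + 1 then geomSeries (i + 1) else 1

open PowerSeries.WithPiTopology in
lemma tendsto_coeff_partialGen (s n : ℕ) :
    Tendsto (fun A => coeff n (partialGen s A)) atTop (𝓝 (regularPartitionCount s n)) := by
  have h := Nat.Partition.hasProd_powerSeriesMk_card_restricted ℕ (fun i => ¬ s ∣ i)
  rw [HasProd, PowerSeries.WithPiTopology.tendsto_iff_coeff_tendsto] at h
  have := h n
  simp only [SummationFilter.unconditional_filter, coeff_mk, Nat.cast_id] at this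
  refine this.congr fun A => ?_
  unfold partialGen
  congr 1
  refine Finset.prod_congr rfl fun i _ => ?_
  split_ifs
  · rfl
  · exact tsum_X_pow_eq_geomSeries (Nat.succ_pos i)

lemma coeff_partialGen_mono (s n : ℕ) : Monotone fun A => coeff n (partialGen s A) := by
  intro A B hAB
  have hc : coeff 0 (partialGen s (B \ A)) = 1 := by
    rw [coeff_zero_eq_constantCoeff_apply, partialGen, map_prod]
    refine Finset.prod_eq_one fun i _ => ?_
    split_ifs
    · simp
    · rw [← coeff_zero_eq_constantCoeff_apply]; simp [geomSeries]
  have : partialGen s B = partialGen s A * partialGen s (B \ A) := by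
    rw [mul_comm]; exact (Finset.prod_sdiff hAB).symm
  simp only [this, coeff_mul]
  have hmem : (n, 0) ∈ Finset.HasAntidiagonal.antidiagonal n := Finset.HasAntidiagonal.mem_antidiagonal.2 (add_zero n)
  refine le_trans ?_ (Finset.single_le_sum (fun _ _ => Nat.zero_le _) hmem)
  rw [hc, mul_one]

/-- The coefficients of the partial products increase to those of the product, which makes the
generating function itself a majorant for the passage to the limit. -/
lemma coeff_partialGen_le (s n : ℕ) (A : Finset ℕ) :
    coeff n (partialGen s A) ≤ regularPartitionCount s n :=
  (coeff_partialGen_mono s n).ge_of_tendsto (tendsto_coeff_partialGen s n) A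

lemma hasSum_coeff_mul {f g : PowerSeries ℕ} {q v w : ℂ}
    (hf : HasSum (fun n => ((coeff n f : ℕ) : ℂ) * q ^ n) v)
    (hg : HasSum (fun n => ((coeff n g : ℕ) : ℂ) * q ^ n) w) :
    HasSum (fun n => ((coeff n (f * g) : ℕ) : ℂ) * q ^ n) (v * w) := by
  have hf' := hf.summable.norm
  have hg' := hg.summable.norm
  have h1 := (summable_norm_sum_mul_antidiagonal_of_summable_norm hf' hg').of_norm.hasSum
  rw [← tsum_mul_tsum_eq_tsum_sum_antidiagonal_of_summable_norm hf' hg', hf.tsum_eq,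
    hg.tsum_eq] at h1
  have h2 : ∀ n, ((coeff n (f * g) : ℕ) : ℂ) * q ^ n = ∑ kl ∈ Finset.HasAntidiagonal.antidiagonal n,
      ((coeff kl.1 f : ℕ) : ℂ) * q ^ kl.1 * (((coeff kl.2 g : ℕ) : ℂ) * q ^ kl.2) := by
    intro n
    rw [coeff_mul, Nat.cast_sum, Finset.sum_mul]
    refine Finset.sum_congr rfl fun p hp => ?_
    rw [← Finset.HasAntidiagonal.mem_antidiagonal.1 hp, pow_add]
    push_cast
    ring
  simpa only [h2] using h1

lemma hasSum_coeff_geomSeries {m : ℕ} (hm : 0 < m) {q : ℂ} (hq : ‖q‖ < 1) :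
    HasSum (fun n => ((coeff n (geomSeries m) : ℕ) : ℂ) * q ^ n) (1 - q ^ m)⁻¹ := by
  have hqm : ‖q ^ m‖ < 1 := by
    rw [norm_pow]; exact pow_lt_one₀ (norm_nonneg _) hq hm.ne'
  have h := hasSum_geometric_of_norm_lt_one hqm
  have hinj : Function.Injective fun j : ℕ => m * j := fun a b h => Nat.eq_of_mul_eq_mul_left hm h
  refine (hinj.hasSum_iff ?_).1 ?_
  · intro n hn
    have : ¬ m ∣ n := fun ⟨c, hc⟩ => hn ⟨c, hc.symm⟩
    simp [geomSeries, this]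
  · simpa [Function.comp_def, geomSeries, pow_mul] using h

/-- The contribution of the part `i + 1` to the logarithm of the generating function. -/
noncomputable def logFactor (s : ℕ) (z : ℂ) (i : ℕ) : ℂ :=
  ∑' j, (logWeight s (i, j) : ℂ) * Complex.exp (-(logExponent (i, j) * z))

lemma norm_exp_neg_lt_one {z : ℂ} (hz : 0 < z.re) : ‖Complex.exp (-z)‖ < 1 := by
  rw [Complex.norm_exp]; simpa using hz

lemma exp_logFactor {z : ℂ} (hz : 0 < z.re) (s i : ℕ) :
    Complex.exp (logFactor s z i) =
      if ¬ s ∣ i + 1 then (1 - Complex.exp (-z) ^ (i + 1))⁻¹ else 1 := by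
  unfold logFactor logWeight
  by_cases h : s ∣ i + 1
  · simp [h]
  · have hq : ‖Complex.exp (-z) ^ (i + 1)‖ < 1 := by
      rw [norm_pow]; exact pow_lt_one₀ (norm_nonneg _) (norm_exp_neg_lt_one hz) (by omega)
    have h1 := Complex.hasSum_taylorSeries_neg_log' hq
    have h2 : ∀ j : ℕ, ((((if s ∣ (i, j).1 + 1 then 0 else 1 / (((i, j).2 : ℝ) + 1)) : ℝ) : ℂ)) *
        Complex.exp (-(logExponent (i, j) * z)) =
        (Complex.exp (-z) ^ (i + 1)) ^ (j + 1) / (j + 1) := by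
      intro j
      rw [if_neg h, ← pow_mul, ← Complex.exp_nat_mul]
      unfold logExponent
      push_cast
      rw [mul_neg]
      ring
    rw [tsum_congr h2, h1.tsum_eq, if_pos h, Complex.exp_neg, Complex.exp_log]
    intro h0
    rw [sub_eq_zero] at h0
    rw [← h0] at hq
    simp at hq

lemma hasSum_coeff_partialGen {z : ℂ} (hz : 0 < z.re) (s : ℕ) (A : Finset ℕ) :
    HasSum (fun n => ((coeff n (partialGen s A) : ℕ) : ℂ) * Complex.exp (-z) ^ n)
      (Complex.exp (∑ i ∈ A, logFactor s z i)) := by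
  have hone : HasSum (fun n => ((coeff n (1 : PowerSeries ℕ) : ℕ) : ℂ) * Complex.exp (-z) ^ n) 1 := by
    convert hasSum_ite_eq 0 (1 : ℂ) using 2 with n
    rw [coeff_one]
    split_ifs with h <;> simp [h]
  induction A using Finset.induction_on with
  | empty => simpa [partialGen] using hone
  | insert i A hi ih =>
    rw [Finset.sum_insert hi, Complex.exp_add]
    have : partialGen s (insert i A) =
        (if ¬ s ∣ i + 1 then geomSeries (i + 1) else 1) * partialGen s A := Finset.prod_insert hi
    rw [this]
    refine hasSum_coeff_mul ?_ ih
    rw [exp_logFactor hz]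
    split_ifs
    · exact hone
    · exact hasSum_coeff_geomSeries (Nat.succ_pos i) (norm_exp_neg_lt_one hz)

lemma tendsto_exp_sum_logFactor {z : ℂ} (hz : 0 < z.re) (s : ℕ) :
    Tendsto (fun A => Complex.exp (∑ i ∈ A, logFactor s z i)) atTop
      (𝓝 (Complex.exp (logGen s z))) := by
  have h := summable_logGen hz s
  have h2 : HasSum (logFactor s z) (logGen s z) :=
    h.hasSum.prod_fiberwise fun i => (h.prod_factor i).hasSum
  exact (Complex.continuous_exp.tendsto _).comp h2

lemma summable_regularPartitionCount {t : ℝ} (ht : 0 < t) (s : ℕ) :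
    Summable fun n => (regularPartitionCount s n : ℝ) * Real.exp (-t) ^ n := by
  have hz : 0 < ((t : ℂ)).re := by simpa using ht
  refine summable_of_sum_le (c := ‖Complex.exp (logGen s t)‖) (fun n => by positivity) fun T => ?_
  have h1 : Tendsto (fun A => ∑ n ∈ T, ((coeff n (partialGen s A) : ℕ) : ℝ) * Real.exp (-t) ^ n)
      atTop (𝓝 (∑ n ∈ T, (regularPartitionCount s n : ℝ) * Real.exp (-t) ^ n)) := by
    refine tendsto_finsetSum _ fun n _ => Tendsto.mul_const _ ?_
    exact (continuous_of_discreteTopology (f := fun k : ℕ => (k : ℝ))).continuousAt.tendsto.comp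
      (tendsto_coeff_partialGen s n)
  refine le_of_tendsto_of_tendsto' h1 (tendsto_exp_sum_logFactor hz s).norm fun A => ?_
  have h2 := hasSum_coeff_partialGen hz s A
  have h3 : ∀ n, ((coeff n (partialGen s A) : ℕ) : ℂ) * Complex.exp (-(t : ℂ)) ^ n =
      (((coeff n (partialGen s A) : ℕ) : ℝ) * Real.exp (-t) ^ n : ℝ) := by
    intro n; push_cast; rfl
  rw [← h2.tsum_eq, tsum_congr h3, ← Complex.ofReal_tsum, Complex.norm_real]
  have h4 : Summable fun n => ((coeff n (partialGen s A) : ℕ) : ℝ) * Real.exp (-t) ^ n := by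
    have := h2.summable
    simp_rw [h3] at this
    exact Complex.summable_ofReal.1 this
  exact (h4.sum_le_tsum T fun n _ => by positivity).trans (le_abs_self _)

/-- Euler's product for the generating function of `s`-regular partitions, in logarithmic form. -/
theorem hasSum_regularPartitionCount {z : ℂ} (hz : 0 < z.re) (s : ℕ) :
    HasSum (fun n : ℕ => (regularPartitionCount s n : ℂ) * Complex.exp (-z) ^ n)
      (Complex.exp (logGen s z)) := by
  have hnorm : ‖Complex.exp (-z)‖ = Real.exp (-z.re) := by rw [Complex.norm_exp]; simp
  have hs := summable_regularPartitionCount hz s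
  have hsum : Summable fun n : ℕ => (regularPartitionCount s n : ℂ) * Complex.exp (-z) ^ n := by
    refine Summable.of_norm (hs.congr fun n => ?_)
    rw [norm_mul, norm_pow, hnorm, Complex.norm_natCast]
  have h1 : Tendsto (fun A => ∑' n, ((coeff n (partialGen s A) : ℕ) : ℂ) * Complex.exp (-z) ^ n) atTop
      (𝓝 (∑' n : ℕ, (regularPartitionCount s n : ℂ) * Complex.exp (-z) ^ n)) := by
    refine tendsto_tsum_of_dominated_convergence hs (fun n => Tendsto.mul_const _ ?_)
      (Eventually.of_forall fun A n => ?_)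
    · exact (continuous_of_discreteTopology (f := fun k : ℕ => (k : ℂ))).continuousAt.tendsto.comp
        (tendsto_coeff_partialGen s n)
    · rw [norm_mul, norm_pow, hnorm, Complex.norm_natCast]
      gcongr
      exact coeff_partialGen_le s n A
  have h2 := tendsto_exp_sum_logFactor hz s
  rw [← tendsto_nhds_unique (h1.congr fun A => (hasSum_coeff_partialGen hz s A).tsum_eq) h2]
  exact hsum.hasSum

end GeneratingFunction

/-! ### Moments of the double series -/

/-- The `j`-th moment of the double series at `e^{-t}`, which up to sign is the `j`-th derivative of
`logGen s` at `t`. -/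
noncomputable def moment (s j : ℕ) (t : ℝ) : ℝ :=
  ∑' p, logWeight s p * ((logExponent p : ℝ) ^ j * Real.exp (-(logExponent p * t)))

lemma summable_one_div_succ_sq : Summable fun k : ℕ => 1 / ((k : ℝ) + 1) ^ 2 := by
  have := (summable_nat_add_iff 1).2 (Real.summable_one_div_nat_pow.2 one_lt_two)
  simpa using this

lemma hasSum_exp_neg_succ {x : ℝ} (hx : 0 < x) :
    HasSum (fun i : ℕ => Real.exp (-((i + 1) * x))) (Real.exp (-x) / (1 - Real.exp (-x))) := by
  have := (hasSum_geometric_of_lt_one (Real.exp_pos (-x)).le (by simpa using hx)).mul_left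
    (Real.exp (-x))
  rw [div_eq_mul_inv]
  refine this.congr_of_eq fun i => ?_
  rw [← Real.exp_nat_mul, ← Real.exp_add]
  congr 1
  ring

lemma exp_neg_div_one_sub_exp_neg_le {x : ℝ} (hx : 0 < x) :
    Real.exp (-x) / (1 - Real.exp (-x)) ≤ 1 / x := by
  have h1 : Real.exp (-x) < 1 := by simpa using hx
  have h2 := Real.add_one_le_exp x
  have h3 : Real.exp x * Real.exp (-x) = 1 := by rw [← Real.exp_add]; simp
  rw [div_le_div_iff₀ (by linarith) hx]
  nlinarith [Real.exp_pos (-x)]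

lemma logWeight_le_inv (s : ℕ) (p : ℕ × ℕ) : logWeight s p ≤ 1 / (p.2 + 1) := by
  unfold logWeight
  split_ifs
  · positivity
  · exact le_rfl

lemma tsum_logWeight_mul_exp_le {t : ℝ} (ht : 0 < t) (s : ℕ) :
    ∑' p, logWeight s p * Real.exp (-(logExponent p * t)) ≤
      (∑' k : ℕ, 1 / ((k : ℝ) + 1) ^ 2) / t := by
  have hs : Summable fun p => logWeight s p * Real.exp (-(logExponent p * t)) := by
    simpa using summable_logWeight_mul ht s 0
  have hs' := hs.prod_symm
  rw [← (Equiv.prodComm ℕ ℕ).tsum_eq, ← tsum_div_const]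
  simp only [Equiv.prodComm_apply]
  rw [hs'.tsum_prod]
  refine hs'.prod.tsum_le_tsum (fun k => ?_) (summable_one_div_succ_sq.div_const t)
  have hx : 0 < ((k : ℝ) + 1) * t := by positivity
  have h := (hasSum_exp_neg_succ hx).mul_left (1 / ((k : ℝ) + 1))
  refine ((hs'.prod_factor k).tsum_le_tsum (fun i => ?_) h.summable).trans ?_
  · have e : (logExponent (i, k) : ℝ) * t = (i + 1) * ((k + 1) * t) := by
      unfold logExponent; push_cast; ring
    simp only [Prod.swap_prod_mk, e]
    exact mul_le_mul_of_nonneg_right (logWeight_le_inv s (i, k)) (Real.exp_pos _).le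
  · rw [h.tsum_eq]
    refine (mul_le_mul_of_nonneg_left (exp_neg_div_one_sub_exp_neg_le hx) (by positivity)).trans
      (le_of_eq ?_)
    field_simp

lemma moment_nonneg (s j : ℕ) (t : ℝ) : 0 ≤ moment s j t :=
  tsum_nonneg fun p => mul_nonneg (logWeight_nonneg s p) (by positivity)

lemma exists_moment_le (j : ℕ) : ∃ C > 0, ∀ s : ℕ, ∀ t : ℝ, 0 < t → moment s j t ≤ C / t ^ (j + 1) := by
  set S := ∑' k : ℕ, 1 / ((k : ℝ) + 1) ^ 2
  have hS : 0 < S := summable_one_div_succ_sq.tsum_pos (fun _ => by positivity) 0 (by simp)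
  have hf : (0 : ℝ) < j.factorial := by exact_mod_cast j.factorial_pos
  refine ⟨j.factorial * 2 ^ j * (2 * S), by positivity, fun s t ht => ?_⟩
  have h0 : Summable fun p => logWeight s p * Real.exp (-(logExponent p * (t / 2))) := by
    simpa using summable_logWeight_mul (half_pos ht) s 0
  have h1 := (summable_logWeight_mul ht s j).tsum_le_tsum (fun p => ?_)
    (h0.mul_left (j.factorial * 2 ^ j / t ^ j))
  · refine h1.trans ?_
    rw [tsum_mul_left]
    refine (mul_le_mul_of_nonneg_left (tsum_logWeight_mul_exp_le (half_pos ht) s)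
      (by positivity)).trans (le_of_eq ?_)
    simp only [S]
    rw [pow_succ]
    field_simp
  · have := mul_le_mul_of_nonneg_left (pow_mul_exp_neg_le (Nat.cast_nonneg (logExponent p)) ht j)
      (logWeight_nonneg s p)
    exact this.trans (le_of_eq (by ring))

/-- `x² ∑ (i + 1) e^{-(i + 1) x}` in closed form. -/
noncomputable def sinhKernel (x : ℝ) : ℝ := (x / 2 / Real.sinh (x / 2)) ^ 2

lemma sinhKernel_nonneg (x : ℝ) : 0 ≤ sinhKernel x := sq_nonneg _

lemma sinhKernel_le_one {x : ℝ} (hx : 0 < x) : sinhKernel x ≤ 1 := by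
  have h := Real.self_le_sinh_iff.2 (half_pos hx).le
  have h2 : 0 < Real.sinh (x / 2) := lt_of_lt_of_le (half_pos hx) h
  refine pow_le_one₀ (by positivity) ((div_le_one h2).2 h)

lemma tendsto_sinhKernel : Tendsto sinhKernel (𝓝[>] 0) (𝓝 1) := by
  have h1 : Tendsto (fun y : ℝ => Real.sinh y / y) (𝓝[>] 0) (𝓝 1) := by
    have := (Real.hasDerivAt_sinh 0).tendsto_slope_zero_right
    simpa [div_eq_inv_mul] using this
  have h2 : Tendsto (fun x : ℝ => x / 2) (𝓝[>] 0) (𝓝[>] 0) := by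
    refine tendsto_nhdsWithin_iff.2 ⟨?_, ?_⟩
    · have : Tendsto (fun x : ℝ => x / 2) (𝓝 0) (𝓝 (0 / 2)) := tendsto_id.div_const 2
      rw [zero_div] at this
      exact this.mono_left nhdsWithin_le_nhds
    · filter_upwards [self_mem_nhdsWithin] with x hx
      exact half_pos (Set.mem_Ioi.1 hx)
  have h3 := ((h1.comp h2).inv₀ one_ne_zero).pow 2
  rw [inv_one, one_pow] at h3
  refine h3.congr fun x => ?_
  simp [sinhKernel]

lemma hasSum_succ_mul_exp_neg {x : ℝ} (hx : 0 < x) :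
    HasSum (fun i : ℕ => ((i : ℝ) + 1) * Real.exp (-((i + 1) * x))) (sinhKernel x / x ^ 2) := by
  have hr : ‖Real.exp (-x)‖ < 1 := by
    rw [Real.norm_eq_abs, abs_of_pos (Real.exp_pos _)]; simpa using hx
  have h := hasSum_coe_mul_geometric_of_norm_lt_one hr
  rw [← hasSum_nat_add_iff' 1] at h
  have hd : 1 - Real.exp (-x) ≠ 0 := by
    have : Real.exp (-x) < 1 := by simpa using hx
    linarith
  have e : sinhKernel x / x ^ 2 = Real.exp (-x) / (1 - Real.exp (-x)) ^ 2 := by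
    have h1 : Real.sinh (x / 2) = Real.exp (x / 2) * (1 - Real.exp (-x)) / 2 := by
      rw [Real.sinh_eq, mul_sub, ← Real.exp_add]
      congr 3
      · ring
      · ring_nf
    have h2 : Real.exp (x / 2) ^ 2 * Real.exp (-x) = 1 := by
      rw [← Real.exp_nat_mul, ← Real.exp_add, Real.exp_eq_one_iff]
      push_cast
      ring
    have h3 := Real.exp_pos (x / 2)
    rw [sinhKernel, h1]
    field_simp
    linarith
  rw [e]
  simp only [Finset.range_one, Finset.sum_singleton, Nat.cast_zero, zero_mul, sub_zero] at h
  refine h.congr_of_eq fun i => ?_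
  rw [← Real.exp_nat_mul]
  push_cast
  congr 2
  ring

/-- Restricting to parts not divisible by `s` subtracts the dilated sum. -/
lemma hasSum_regular_succ_mul_exp_neg {s : ℕ} (hs : 0 < s) {x : ℝ} (hx : 0 < x) :
    HasSum (fun i : ℕ => (if s ∣ i + 1 then 0 else (i : ℝ) + 1) * Real.exp (-((i + 1) * x)))
      ((sinhKernel x - sinhKernel (s * x) / s) / x ^ 2) := by
  have hs' : (0 : ℝ) < s := by exact_mod_cast hs
  have h1 := hasSum_succ_mul_exp_neg hx
  have h2 := (hasSum_succ_mul_exp_neg (mul_pos hs' hx)).mul_left (s : ℝ)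
  have hinj : Function.Injective fun i : ℕ => s * (i + 1) - 1 := by
    intro a b h
    have ha : 0 < s * (a + 1) := by positivity
    have hb : 0 < s * (b + 1) := by positivity
    have h' : s * (a + 1) = s * (b + 1) := by
      simp only at h
      omega
    have := Nat.eq_of_mul_eq_mul_left hs h'
    omega
  have h3 : HasSum (fun i : ℕ => (if s ∣ i + 1 then (i : ℝ) + 1 else 0) * Real.exp (-((i + 1) * x)))
      (s * (sinhKernel (s * x) / (s * x) ^ 2)) := by
    refine (hinj.hasSum_iff ?_).1 (h2.congr_of_eq fun i => ?_)
    · intro n hn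
      have : ¬ s ∣ n + 1 := by
        rintro ⟨c, hc⟩
        rcases Nat.eq_zero_or_pos c with rfl | hc0
        · simp at hc
        · refine hn ⟨c - 1, ?_⟩
          simp only
          rw [Nat.sub_add_cancel hc0, ← hc, Nat.add_sub_cancel]
      simp [this]
    · have hpos : 0 < s * (i + 1) := by positivity
      have e1 : s * (i + 1) - 1 + 1 = s * (i + 1) := Nat.sub_add_cancel hpos
      have e2 : ((s * (i + 1) - 1 : ℕ) : ℝ) + 1 = s * (i + 1) := by exact_mod_cast e1
      simp only [Function.comp, e1, e2, dvd_mul_right, if_true]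
      rw [show (s : ℝ) * (i + 1) * x = (i + 1) * (s * x) by ring]
      ring
  have h4 := h1.sub h3
  have e : (sinhKernel x - sinhKernel (s * x) / s) / x ^ 2 =
      sinhKernel x / x ^ 2 - s * (sinhKernel (s * x) / (s * x) ^ 2) := by
    field_simp
  rw [e]
  refine h4.congr_of_eq fun i => ?_
  split_ifs <;> ring

lemma hasSum_sq_mul_moment_one {s : ℕ} (hs : 0 < s) {t : ℝ} (ht : 0 < t) :
    HasSum (fun k : ℕ => (sinhKernel ((k + 1) * t) - sinhKernel (s * ((k + 1) * t)) / s)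
      / ((k : ℝ) + 1) ^ 2) (t ^ 2 * moment s 1 t) := by
  have h := (summable_logWeight_mul ht s 1)
  have h2 := h.prod_symm.hasSum
  have h3 := (h2.prod_fiberwise (g := fun k : ℕ => (sinhKernel ((k + 1) * t) -
    sinhKernel (s * ((k + 1) * t)) / s) / ((k + 1) * t) ^ 2) fun k => ?_).mul_left (t ^ 2)
  · have e : ∑' p : ℕ × ℕ, logWeight s p.swap *
      ((logExponent p.swap : ℝ) ^ 1 * Real.exp (-(logExponent p.swap * t))) = moment s 1 t :=
      (Equiv.prodComm ℕ ℕ).tsum_eq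
        (fun p => logWeight s p * ((logExponent p : ℝ) ^ 1 * Real.exp (-(logExponent p * t))))
    rw [e] at h3
    refine h3.congr_of_eq fun k => ?_
    field_simp
  · refine (hasSum_regular_succ_mul_exp_neg hs
      (by positivity : 0 < ((k : ℝ) + 1) * t)).congr_of_eq fun i => ?_
    have e : (logExponent (i, k) : ℝ) * t = (i + 1) * ((k + 1) * t) := by
      unfold logExponent; push_cast; ring
    simp only [Prod.swap_prod_mk, e, pow_one]
    unfold logWeight logExponent
    split_ifs
    · ring
    · push_cast
      field_simp

/-- The constant in `moment s 1 t ∼ C / t²`. -/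
noncomputable def meanConst (s : ℕ) : ℝ := ∑' k : ℕ, (1 - 1 / (s : ℝ)) / ((k : ℝ) + 1) ^ 2

lemma meanConst_pos {s : ℕ} (hs : 2 ≤ s) : 0 < meanConst s := by
  have h : (1 : ℝ) / s < 1 := by
    rw [div_lt_one (by positivity)]
    exact_mod_cast (by omega : 1 < s)
  have h1 : 0 < 1 - 1 / (s : ℝ) := by linarith
  have : Summable fun k : ℕ => (1 - 1 / (s : ℝ)) / ((k : ℝ) + 1) ^ 2 :=
    (summable_one_div_succ_sq.mul_left (1 - 1 / (s : ℝ))).congr fun k => by ring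
  exact this.tsum_pos (fun k => by positivity) 0 (by simpa using h1)

lemma tendsto_sq_mul_moment_one {s : ℕ} (hs : 0 < s) :
    Tendsto (fun t => t ^ 2 * moment s 1 t) (𝓝[>] 0) (𝓝 (meanConst s)) := by
  have hs' : (0 : ℝ) < s := by exact_mod_cast hs
  have hs1 : (1 : ℝ) ≤ s := by exact_mod_cast hs
  have hmul : ∀ c : ℝ, 0 < c → Tendsto (fun t : ℝ => c * t) (𝓝[>] 0) (𝓝[>] 0) := by
    intro c hc
    refine tendsto_nhdsWithin_iff.2 ⟨?_, ?_⟩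
    · have : Tendsto (fun x : ℝ => c * x) (𝓝 0) (𝓝 (c * 0)) := tendsto_id.const_mul c
      rw [mul_zero] at this
      exact this.mono_left nhdsWithin_le_nhds
    · filter_upwards [self_mem_nhdsWithin] with x hx
      exact mul_pos hc (Set.mem_Ioi.1 hx)
  have := tendsto_tsum_of_dominated_convergence (𝓕 := 𝓝[>] (0 : ℝ))
    (f := fun t (k : ℕ) => (sinhKernel ((k + 1) * t) - sinhKernel (s * ((k + 1) * t)) / s)
      / ((k : ℝ) + 1) ^ 2) (g := fun k : ℕ => (1 - 1 / (s : ℝ)) / ((k : ℝ) + 1) ^ 2)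
    summable_one_div_succ_sq (fun k => ?_) ?_
  · refine this.congr' ?_
    filter_upwards [self_mem_nhdsWithin] with t ht
    exact (hasSum_sq_mul_moment_one hs ht).tsum_eq
  · have h1 := tendsto_sinhKernel.comp (hmul ((k : ℝ) + 1) (by positivity))
    have h2 := tendsto_sinhKernel.comp (hmul (s * ((k : ℝ) + 1)) (by positivity))
    refine ((h1.sub (h2.div_const (s : ℝ))).div_const (((k : ℝ) + 1) ^ 2)).congr fun t => ?_
    simp only [Function.comp, mul_assoc]
  · filter_upwards [self_mem_nhdsWithin] with t ht k
    have ht' : (0 : ℝ) < t := ht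
    have a1 := sinhKernel_nonneg ((k + 1) * t)
    have a2 := sinhKernel_nonneg (s * ((k + 1) * t))
    have a3 := sinhKernel_le_one (by positivity : 0 < ((k : ℝ) + 1) * t)
    have a4 := sinhKernel_le_one (by positivity : 0 < (s : ℝ) * (((k : ℝ) + 1) * t))
    have a5 : sinhKernel (s * ((k + 1) * t)) / s ≤ 1 := by
      rw [div_le_one hs']; linarith
    have a6 : 0 ≤ sinhKernel (s * ((k + 1) * t)) / s := by positivity
    rw [Real.norm_eq_abs, abs_div, abs_of_pos (by positivity : 0 < ((k : ℝ) + 1) ^ 2)]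
    gcongr
    rw [abs_le]
    constructor <;> linarith

lemma continuousOn_moment (s j : ℕ) : ContinuousOn (moment s j) (Set.Ioi 0) := by
  intro t0 ht0
  have ht0' : (0 : ℝ) < t0 := ht0
  have h : ContinuousOn (moment s j) (Set.Ioi (t0 / 2)) := by
    refine continuousOn_tsum (fun p => by fun_prop) (summable_logWeight_mul (half_pos ht0') s j) ?_
    intro p t ht
    have ht' : t0 / 2 < t := ht
    have := logWeight_nonneg s p
    rw [Real.norm_eq_abs, abs_of_nonneg (by positivity)]
    gcongr
  exact (h.continuousAt (Ioi_mem_nhds (by linarith))).continuousWithinAt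

/-- The saddle point: every positive mean is attained. -/
lemma exists_moment_one_eq {s : ℕ} (hs : 2 ≤ s) {y : ℝ} (hy : 0 < y) :
    ∃ t, 0 < t ∧ moment s 1 t = y := by
  obtain ⟨C, hC, hle⟩ := exists_moment_le 1
  have hinf : Tendsto (moment s 1) (𝓝[>] 0) atTop := by
    have h1 : Tendsto (fun t : ℝ => (t ^ 2)⁻¹) (𝓝[>] 0) atTop := by
      refine tendsto_inv_nhdsGT_zero.comp (tendsto_nhdsWithin_iff.2 ⟨?_, ?_⟩)
      · have : Tendsto (fun x : ℝ => x ^ 2) (𝓝 0) (𝓝 (0 ^ 2)) := tendsto_id.pow 2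
        rw [zero_pow two_ne_zero] at this
        exact this.mono_left nhdsWithin_le_nhds
      · filter_upwards [self_mem_nhdsWithin] with x hx
        exact pow_pos (Set.mem_Ioi.1 hx) 2
    have h2 := (tendsto_sq_mul_moment_one (by omega : 0 < s)).pos_mul_atTop (meanConst_pos hs) h1
    refine h2.congr' ?_
    filter_upwards [self_mem_nhdsWithin] with t ht
    have : (0 : ℝ) < t := ht
    field_simp
  obtain ⟨a, hay, ha⟩ := ((hinf.eventually_ge_atTop y).and self_mem_nhdsWithin).exists
  have ha' : (0 : ℝ) < a := ha
  set b := max a (Real.sqrt (C / y)) with hb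
  have hb0 : 0 < b := lt_of_lt_of_le ha' (le_max_left _ _)
  have hby : moment s 1 b ≤ y := by
    refine (hle s b hb0).trans ?_
    rw [div_le_iff₀ (by positivity), ← div_le_iff₀' hy]
    calc C / y = Real.sqrt (C / y) ^ 2 := (Real.sq_sqrt (by positivity)).symm
      _ ≤ b ^ (1 + 1) := by
        have := le_max_right a (Real.sqrt (C / y))
        gcongr
  have hsub : Set.Icc a b ⊆ Set.Ioi 0 := fun x hx => lt_of_lt_of_le ha' hx.1
  obtain ⟨t, ht, hty⟩ := intermediate_value_Icc' (le_max_left _ _)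
    ((continuousOn_moment s 1).mono hsub) ⟨hby, hay⟩
  exact ⟨t, hsub ht, hty⟩

/-! ### Decay of the generating function off the real axis -/

/-- The drop of `Re (logGen s)` from `t` to `t - θ i`. -/
noncomputable def logGap (s : ℕ) (t θ : ℝ) : ℝ :=
  ∑' p, logWeight s p * (Real.exp (-(logExponent p * t)) * (1 - Real.cos (logExponent p * θ)))

lemma one_sub_cos_nonneg (x : ℝ) : 0 ≤ 1 - Real.cos x := by linarith [Real.cos_le_one x]

lemma summable_logGap {t : ℝ} (ht : 0 < t) (s : ℕ) (θ : ℝ) :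
    Summable fun p => logWeight s p *
      (Real.exp (-(logExponent p * t)) * (1 - Real.cos (logExponent p * θ))) := by
  refine Summable.of_nonneg_of_le (fun p => ?_) (fun p => ?_)
    ((summable_exp_neg_logExponent ht).mul_left 2)
  · exact mul_nonneg (logWeight_nonneg s p)
      (mul_nonneg (Real.exp_pos _).le (one_sub_cos_nonneg _))
  · have h1 : 1 - Real.cos (logExponent p * θ) ≤ 2 := by
      linarith [Real.neg_one_le_cos (logExponent p * θ)]
    refine (mul_le_of_le_one_left (mul_nonneg (Real.exp_pos _).le (one_sub_cos_nonneg _))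
      (logWeight_le_one s p)).trans ?_
    rw [mul_comm]
    exact mul_le_mul_of_nonneg_right h1 (Real.exp_pos _).le

lemma logGap_le_moment {t : ℝ} (ht : 0 < t) (s : ℕ) (θ : ℝ) :
    logGap s t θ ≤ θ ^ 2 / 2 * moment s 2 t := by
  rw [moment, ← tsum_mul_left]
  refine (summable_logGap ht s θ).tsum_le_tsum (fun p => ?_)
    ((summable_logWeight_mul ht s 2).mul_left _)
  have h := Real.one_sub_sq_div_two_le_cos (x := logExponent p * θ)
  have h2 : 1 - Real.cos (logExponent p * θ) ≤ θ ^ 2 / 2 * (logExponent p : ℝ) ^ 2 := by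
    nlinarith
  calc logWeight s p * (Real.exp (-(logExponent p * t)) * (1 - Real.cos (logExponent p * θ)))
      ≤ logWeight s p * (Real.exp (-(logExponent p * t)) * (θ ^ 2 / 2 * (logExponent p : ℝ) ^ 2)) := by
        gcongr
        exact logWeight_nonneg s p
    _ = _ := by ring

/-- The parts congruent to `1` modulo `s` alone bound the gap from below. -/
lemma tsum_progression_le_logGap {s : ℕ} (hs : 2 ≤ s) {t : ℝ} (ht : 0 < t) (θ : ℝ) :
    (Summable fun i : ℕ => Real.exp (-((s * i + 1) * t)) * (1 - Real.cos ((s * i + 1) * θ))) ∧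
    ∑' i : ℕ, Real.exp (-((s * i + 1) * t)) * (1 - Real.cos ((s * i + 1) * θ)) ≤ logGap s t θ := by
  have hinj : Function.Injective fun i : ℕ => ((s * i, 0) : ℕ × ℕ) := by
    intro a b h
    exact Nat.eq_of_mul_eq_mul_left (by omega : 0 < s) (Prod.ext_iff.1 h).1
  have e : ∀ i : ℕ, Real.exp (-((s * i + 1) * t)) * (1 - Real.cos ((s * i + 1) * θ)) =
      logWeight s (s * i, 0) * (Real.exp (-(logExponent (s * i, 0) * t)) *
        (1 - Real.cos (logExponent (s * i, 0) * θ))) := by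
    intro i
    have : ¬ s ∣ s * i + 1 := by
      intro h
      have := (Nat.dvd_add_right (dvd_mul_right s i)).1 h
      have := Nat.le_of_dvd one_pos this
      omega
    simp [logWeight, logExponent, this]
  have hsum := summable_logGap ht s θ
  have h1 := hsum.comp_injective hinj
  refine ⟨h1.congr fun i => (e i).symm, ?_⟩
  rw [tsum_congr e]
  exact h1.tsum_le_tsum_of_inj _ hinj (fun p _ => mul_nonneg (logWeight_nonneg s p)
    (mul_nonneg (Real.exp_pos _).le (one_sub_cos_nonneg _))) (fun _ => le_rfl) hsum

lemma one_third_le_exp_neg_one : 1 / 3 ≤ Real.exp (-1) := by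
  have := Real.exp_one_lt_d9
  have h : Real.exp 1 * Real.exp (-1) = 1 := by rw [← Real.exp_add]; simp
  nlinarith [Real.exp_pos (-1)]

lemma sq_div_five_le_one_sub_cos {x : ℝ} (hx : |x| ≤ Real.pi) : x ^ 2 / 5 ≤ 1 - Real.cos x := by
  have h := Real.cos_le_one_sub_mul_cos_sq hx
  have hpi : Real.pi ^ 2 < 10 := by
    nlinarith [Real.pi_lt_d2, Real.pi_pos]
  have : 1 / 5 ≤ 2 / Real.pi ^ 2 := by
    rw [div_le_div_iff₀ (by norm_num) (by positivity)]
    linarith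
  nlinarith [sq_nonneg x]

lemma cube_div_three_le_sum_sq (K : ℕ) : (K : ℝ) ^ 3 / 3 ≤ ∑ i ∈ Finset.range K, ((i : ℝ) + 1) ^ 2 := by
  induction K with
  | zero => simp
  | succ K ih =>
    rw [Finset.sum_range_succ]
    push_cast
    nlinarith [(Nat.cast_nonneg K : (0 : ℝ) ≤ K)]

/-- The terms of the progression up to `1 / t` are not damped. -/
lemma sum_one_sub_cos_le_logGap {s : ℕ} (hs : 2 ≤ s) {t : ℝ} (ht : 0 < t) (θ : ℝ) {K : ℕ}
    (hK : s * K * t ≤ 1) :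
    1 / 3 * ∑ i ∈ Finset.range K, (1 - Real.cos ((s * i + 1) * θ)) ≤ logGap s t θ := by
  obtain ⟨h1, h2⟩ := tsum_progression_le_logGap hs ht θ
  refine le_trans ?_ ((h1.sum_le_tsum (Finset.range K) fun i _ =>
    mul_nonneg (Real.exp_pos _).le (one_sub_cos_nonneg _)).trans h2)
  rw [Finset.mul_sum]
  refine Finset.sum_le_sum fun i hi => mul_le_mul_of_nonneg_right ?_ (one_sub_cos_nonneg _)
  refine one_third_le_exp_neg_one.trans (Real.exp_le_exp.2 (neg_le_neg ?_))
  refine le_trans (mul_le_mul_of_nonneg_right ?_ ht.le) hK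
  have : s * i + 1 ≤ s * K := by
    have := Finset.mem_range.1 hi
    nlinarith
  exact_mod_cast this

lemma exists_natCast_mul_le_one {s : ℕ} (hs : 2 ≤ s) {t : ℝ} (ht : 0 < t) (hst : s * t ≤ 1) :
    ∃ K : ℕ, s * K * t ≤ 1 ∧ 1 / (2 * s * t) ≤ K := by
  have hs0 : (0 : ℝ) < s := by exact_mod_cast (by omega : 0 < s)
  have h1 : 1 ≤ 1 / (s * t) := by rw [le_div_iff₀ (by positivity)]; linarith
  refine ⟨⌊1 / (s * t)⌋₊, ?_, ?_⟩
  · have := Nat.floor_le (by positivity : 0 ≤ 1 / (s * t))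
    rw [le_div_iff₀ (by positivity)] at this
    linarith
  · have h2 := Nat.lt_floor_add_one (1 / (s * t))
    have h3 : (1 : ℝ) ≤ ⌊1 / (s * t)⌋₊ := by exact_mod_cast Nat.le_floor (by simpa using h1)
    have : 1 / (2 * s * t) = 1 / (s * t) / 2 := by field_simp
    linarith

/-- Near zero the gap is quadratic. -/
lemma le_logGap_of_abs_le {s : ℕ} (hs : 2 ≤ s) {t θ : ℝ} (ht : 0 < t) (hst : s * t ≤ 1)
    (hθ : |θ| ≤ t) : 1 / (360 * s ^ 3) * (θ ^ 2 / t ^ 3) ≤ logGap s t θ := by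
  have hs0 : (0 : ℝ) < s := by exact_mod_cast (by omega : 0 < s)
  have hs1 : (1 : ℝ) ≤ s := by exact_mod_cast (by omega : 1 ≤ s)
  obtain ⟨K, hK1, hK2⟩ := exists_natCast_mul_le_one hs ht hst
  refine le_trans ?_ (sum_one_sub_cos_le_logGap hs ht θ hK1)
  have h1 : ∑ i ∈ Finset.range K, ((i : ℝ) + 1) ^ 2 * (θ ^ 2 / 5) ≤
      ∑ i ∈ Finset.range K, (1 - Real.cos ((s * i + 1) * θ)) := by
    refine Finset.sum_le_sum fun i hi => ?_
    have hi0 : (0 : ℝ) ≤ i := Nat.cast_nonneg i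
    have hiK : (i : ℝ) + 1 ≤ K := by exact_mod_cast Finset.mem_range.1 hi
    have hx : |(s * i + 1) * θ| ≤ Real.pi := by
      rw [abs_mul, abs_of_nonneg (by positivity)]
      have : (s * i + 1) * |θ| ≤ (s * K) * t := by
        have : (s * i + 1 : ℝ) ≤ s * K := by nlinarith
        gcongr
      linarith [Real.pi_gt_three]
    refine le_trans ?_ (sq_div_five_le_one_sub_cos hx)
    have : ((i : ℝ) + 1) ^ 2 ≤ (s * i + 1) ^ 2 := by
      have : (i : ℝ) ≤ s * i := by nlinarith
      gcongr
    nlinarith [sq_nonneg θ]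
  rw [← Finset.sum_mul] at h1
  have h2 := cube_div_three_le_sum_sq K
  have h3 : (1 / (2 * s * t)) ^ 3 ≤ (K : ℝ) ^ 3 := by gcongr
  calc 1 / (360 * s ^ 3) * (θ ^ 2 / t ^ 3) = 1 / 3 * ((1 / (2 * s * t)) ^ 3 / 3 * (θ ^ 2 / 5)) := by
        field_simp
        norm_num
        ring
    _ ≤ 1 / 3 * (∑ i ∈ Finset.range K, ((i : ℝ) + 1) ^ 2 * (θ ^ 2 / 5)) := by
        rw [← Finset.sum_mul]
        gcongr
        linarith
    _ ≤ _ := by rw [← Finset.sum_mul]; gcongr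

/-- Near a nonzero multiple of `2 π / s` the numbers congruent to `1` modulo `s` keep the phase
away from zero. -/
lemma le_logGap_of_near_rational {s : ℕ} (hs : 2 ≤ s) {t θ : ℝ} (ht : 0 < t) (hst : s * t ≤ 1)
    (hθ : |θ| ≤ Real.pi) {j : ℤ} (hj : j ≠ 0) (ha : |s * θ - j * (2 * Real.pi)| ≤ t) :
    1 / (6 * s ^ 3) * (1 / t) ≤ logGap s t θ := by
  have hs0 : (0 : ℝ) < s := by exact_mod_cast (by omega : 0 < s)
  have hs2 : (2 : ℝ) ≤ s := by exact_mod_cast hs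
  have ht2 : t ≤ 1 / 2 := by nlinarith
  obtain ⟨K, hK1, hK2⟩ := exists_natCast_mul_le_one hs ht hst
  refine le_trans ?_ (sum_one_sub_cos_le_logGap hs ht θ hK1)
  set a := s * θ - j * (2 * Real.pi) with ha_def
  have hlow : 11 / 2 ≤ s * |θ| := by
    have h1 : (1 : ℝ) ≤ |(j : ℝ)| := by exact_mod_cast Int.one_le_abs hj
    have h2 : |(j : ℝ) * (2 * Real.pi)| ≤ |s * θ| + |a| := by
      have := abs_sub (s * θ) a
      rwa [ha_def, sub_sub_cancel] at this
    rw [abs_mul (j : ℝ), abs_mul (s : ℝ), abs_of_pos hs0, abs_of_pos Real.two_pi_pos] at h2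
    nlinarith [Real.pi_gt_three]
  have hterm : ∀ i ∈ Finset.range K, 1 / (s : ℝ) ^ 2 ≤ 1 - Real.cos ((s * i + 1) * θ) := by
    intro i hi
    have hiK : (i : ℝ) ≤ K := by exact_mod_cast (Finset.mem_range.1 hi).le
    have hcos : Real.cos ((s * i + 1) * θ) = Real.cos |θ + i * a| := by
      rw [Real.cos_abs, ← Real.cos_add_int_mul_two_pi (θ + i * a) (i * j)]
      congr 1
      rw [ha_def]
      push_cast
      ring
    have hia : s * |i * a| ≤ 1 := by
      rw [abs_mul, Nat.abs_cast]
      calc s * (i * |a|) ≤ s * (K * t) := by gcongr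
        _ ≤ 1 := by linarith
    have hle : |i * a| ≤ 1 / 2 := by nlinarith [abs_nonneg (i * a)]
    have hup : |θ + i * a| ≤ Real.pi + 1 / 2 := (abs_add_le _ _).trans (by linarith)
    have hdn : 4 ≤ s * |θ + i * a| := by
      have h1 : |θ| ≤ |θ + i * a| + |i * a| := by
        have := abs_sub (θ + i * a) (i * a)
        rwa [add_sub_cancel_right] at this
      nlinarith
    rw [hcos]
    rcases le_or_gt |θ + i * a| Real.pi with h | h
    · refine le_trans ?_ (sq_div_five_le_one_sub_cos (by rwa [abs_abs]))
      rw [div_le_div_iff₀ (by positivity) (by norm_num)]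
      nlinarith
    · have h1 : Real.cos |θ + i * a| ≤ 0 :=
        Real.cos_nonpos_of_pi_div_two_le_of_le (by linarith [Real.pi_pos])
          (by linarith [Real.pi_gt_three])
      have h2 : 1 / (s : ℝ) ^ 2 ≤ 1 := by
        rw [div_le_one (by positivity)]; nlinarith
      linarith
  have hsum := Finset.sum_le_sum hterm
  rw [Finset.sum_const, Finset.card_range, nsmul_eq_mul] at hsum
  calc 1 / (6 * s ^ 3) * (1 / t) = 1 / 3 * (1 / (2 * s * t) * (1 / (s : ℝ) ^ 2)) := by
        field_simp
        norm_num
    _ ≤ 1 / 3 * (K * (1 / (s : ℝ) ^ 2)) := by gcongr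
    _ ≤ _ := by gcongr

/-- Away from the multiples of `2 π / s` the geometric series over the progression is smaller than
its value at `θ = 0` by a constant factor. -/
lemma le_logGap_of_far {s : ℕ} (hs : 2 ≤ s) {t θ : ℝ} (ht : 0 < t) (hst : s * t ≤ 1)
    {j : ℤ} (ha : t ≤ |s * θ - j * (2 * Real.pi)|) (ha' : |s * θ - j * (2 * Real.pi)| ≤ Real.pi) :
    1 / (150 * s ^ 3) * (1 / t) ≤ logGap s t θ := by
  have hs0 : (0 : ℝ) < s := by exact_mod_cast (by omega : 0 < s)
  have hs2 : (2 : ℝ) ≤ s := by exact_mod_cast hs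
  have ht2 : t ≤ 1 / 2 := by nlinarith
  obtain ⟨h1, h2⟩ := tsum_progression_le_logGap hs ht θ
  refine le_trans ?_ h2
  set a := s * θ - j * (2 * Real.pi) with ha_def
  set ρ := Real.exp (-(s * t)) with hρ
  have hst0 : 0 < s * t := by positivity
  have hρ1 : ρ < 1 := by simpa [hρ] using hst0
  have hρ3 : 1 / 3 ≤ ρ := one_third_le_exp_neg_one.trans (Real.exp_le_exp.2 (by linarith))
  have hρt : 1 - ρ ≤ s * t := by
    have := Real.add_one_le_exp (-(s * t))
    linarith
  set q := Complex.exp (-t + θ * Complex.I) with hq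
  have hqs : q ^ s = ρ * (Real.cos a + Real.sin a * Complex.I) := by
    rw [hq, ← Complex.exp_nat_mul, Complex.ofReal_cos, Complex.ofReal_sin, ← Complex.exp_mul_I, hρ,
      Complex.ofReal_exp, ← Complex.exp_add, Complex.exp_eq_exp_iff_exists_int]
    refine ⟨j, ?_⟩
    rw [ha_def]
    push_cast
    ring
  have hqs_norm : ‖q ^ s‖ = ρ := by
    rw [hq, ← Complex.exp_nat_mul, Complex.norm_exp, hρ]
    simp
  have hA : HasSum (fun i : ℕ => Real.exp (-((s * i + 1) * t))) (Real.exp (-t) * (1 - ρ)⁻¹) := by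
    refine ((hasSum_geometric_of_lt_one (Real.exp_pos _).le hρ1).mul_left
      (Real.exp (-t))).congr_of_eq fun i => ?_
    rw [← Real.exp_nat_mul, ← Real.exp_add]
    congr 1
    ring
  have hBc : HasSum (fun i : ℕ => q * (q ^ s) ^ i) (q * (1 - q ^ s)⁻¹) :=
    (hasSum_geometric_of_norm_lt_one (by rwa [hqs_norm])).mul_left q
  have hB : HasSum (fun i : ℕ => Real.exp (-((s * i + 1) * t)) * Real.cos ((s * i + 1) * θ))
      (q * (1 - q ^ s)⁻¹).re := by
    refine (Complex.hasSum_re hBc).congr_of_eq fun i => ?_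
    have : q * (q ^ s) ^ i =
        Complex.exp (((-((s * i + 1) * t) : ℝ) : ℂ) + (((s * i + 1) * θ : ℝ) : ℂ) * Complex.I) := by
      rw [hq, ← pow_mul, ← pow_succ', ← Complex.exp_nat_mul]
      congr 1
      push_cast
      ring
    rw [this, Complex.exp_add, ← Complex.ofReal_exp, Complex.re_ofReal_mul, Complex.exp_ofReal_mul_I_re]
  have hgap := (hA.sub hB).congr_of_eq
    (g := fun i : ℕ => Real.exp (-((s * i + 1) * t)) * (1 - Real.cos ((s * i + 1) * θ)))
    fun i => by ring
  rw [hgap.tsum_eq]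
  -- the denominator at `θ` exceeds the one at `0` by the factor `1 + η`
  set η : ℝ := 2 / (45 * s ^ 2) with hη
  have hη0 : 0 < η := by positivity
  have hη1 : η ≤ 1 := by
    rw [hη, div_le_one (by positivity)]; nlinarith
  have hD : (1 - ρ) * (1 + η) ≤ ‖1 - q ^ s‖ := by
    refine abs_le_of_sq_le_sq' ?_ (norm_nonneg _) |>.2
    have e : ‖1 - q ^ s‖ ^ 2 = (1 - ρ) ^ 2 + 2 * ρ * (1 - Real.cos a) := by
      rw [hqs, ← Complex.normSq_eq_norm_sq, Complex.normSq_apply]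
      have := Real.sin_sq_add_cos_sq a
      simp [-Complex.ofReal_cos, -Complex.ofReal_sin]
      nlinarith
    rw [e]
    have h3 := sq_div_five_le_one_sub_cos ha'
    have h4 : t ^ 2 ≤ a ^ 2 := by
      rw [← sq_abs a]; gcongr
    have h5 : 2 / 15 * t ^ 2 ≤ 2 * ρ * (1 - Real.cos a) := by nlinarith [sq_nonneg t]
    have h6 : (1 - ρ) ^ 2 ≤ (s * t) ^ 2 := by
      have : 0 ≤ 1 - ρ := by linarith
      gcongr
    have h7 : 3 * η * (s * t) ^ 2 = 2 / 15 * t ^ 2 := by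
      rw [hη]; field_simp; norm_num
    have h8 : (1 - ρ) ^ 2 * (2 * η + η ^ 2) ≤ (1 - ρ) ^ 2 * (3 * η) := by
      gcongr
      nlinarith
    nlinarith
  have hre : (q * (1 - q ^ s)⁻¹).re ≤ Real.exp (-t) * ((1 - ρ) * (1 + η))⁻¹ := by
    refine (Complex.re_le_norm _).trans ?_
    rw [norm_mul, norm_inv]
    have : ‖q‖ = Real.exp (-t) := by rw [hq, Complex.norm_exp]; simp
    rw [this]
    have : 0 < (1 - ρ) * (1 + η) := mul_pos (by linarith) (by linarith)
    gcongr
  have hρ0 : 0 < 1 - ρ := by linarith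
  have h9 : 1 / 3 ≤ Real.exp (-t) :=
    one_third_le_exp_neg_one.trans (Real.exp_le_exp.2 (by linarith))
  calc 1 / (150 * s ^ 3) * (1 / t) ≤ 1 / 3 * (1 / (s * t)) * (η / 2) := by
        rw [hη, div_mul_div_comm, div_mul_div_comm, div_div, div_mul_div_comm,
          div_le_div_iff₀ (by positivity) (by positivity)]
        ring_nf
        nlinarith [mul_pos (pow_pos hs0 3) ht]
    _ ≤ Real.exp (-t) * (1 / (1 - ρ)) * (η / (1 + η)) := by
        gcongr
        linarith
    _ = Real.exp (-t) * (1 - ρ)⁻¹ - Real.exp (-t) * ((1 - ρ) * (1 + η))⁻¹ := by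
        field_simp
        ring
    _ ≤ _ := by linarith

/-- The generating function decays off the real axis: quadratically at the scale `t ^ (3 / 2)`, and
by a factor `exp (-c / t)` elsewhere. -/
theorem exists_le_logGap {s : ℕ} (hs : 2 ≤ s) : ∃ c > 0, ∀ t θ : ℝ, 0 < t → s * t ≤ 1 →
    |θ| ≤ Real.pi → c * (θ ^ 2 / t ^ 3) ≤ logGap s t θ ∨ c * (1 / t) ≤ logGap s t θ := by
  have hs0 : (0 : ℝ) < s := by exact_mod_cast (by omega : 0 < s)
  have hs1 : (1 : ℝ) ≤ s := by exact_mod_cast (by omega : 1 ≤ s)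
  refine ⟨1 / (360 * s ^ 3), by positivity, fun t θ ht hst hθ => ?_⟩
  set j := round (s * θ / (2 * Real.pi)) with hj
  have hround : |s * θ - j * (2 * Real.pi)| ≤ Real.pi := by
    have h := abs_sub_round (s * θ / (2 * Real.pi))
    have e : s * θ - j * (2 * Real.pi) = (s * θ / (2 * Real.pi) - j) * (2 * Real.pi) := by
      field_simp
    rw [e, abs_mul, abs_of_pos Real.two_pi_pos]
    nlinarith [Real.pi_pos]
  rcases le_or_gt t |s * θ - j * (2 * Real.pi)| with h | h
  · right
    refine le_trans ?_ (le_logGap_of_far hs ht hst h hround)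
    gcongr
    norm_num
  · by_cases h0 : j = 0
    · left
      refine le_logGap_of_abs_le hs ht hst ?_
      rw [h0, Int.cast_zero, zero_mul, sub_zero, abs_mul, abs_of_pos hs0] at h
      nlinarith [abs_nonneg θ]
    · right
      refine le_trans ?_ (le_logGap_of_near_rational hs ht hst hθ h0 h.le)
      gcongr
      norm_num

/-- The second moment is at least of order `t⁻³`: at `θ = t` both alternatives of
`exists_le_logGap` give a gap of order `t⁻¹`, and the gap is at most quadratic in `θ`. -/
lemma exists_le_moment_two {s : ℕ} (hs : 2 ≤ s) :
    ∃ c > 0, ∀ t : ℝ, 0 < t → s * t ≤ 1 → c / t ^ 3 ≤ moment s 2 t := by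
  obtain ⟨c, hc, h⟩ := exists_le_logGap hs
  refine ⟨c, hc, fun t ht hst => ?_⟩
  have hs2 : (2 : ℝ) ≤ s := by exact_mod_cast hs
  have ht1 : t ≤ 1 := by nlinarith
  have h1 : c * (1 / t) ≤ logGap s t t := by
    rcases h t t ht hst (by rw [abs_of_pos ht]; linarith [Real.pi_gt_three]) with h | h
    · refine le_trans (le_of_eq ?_) h
      field_simp
    · exact h
  have h2 := h1.trans (logGap_le_moment ht s t)
  have h3 := moment_nonneg s 2 t
  have h4 : c * (1 / t) ≤ t ^ 2 * moment s 2 t := by nlinarith [sq_nonneg t, mul_nonneg (sq_nonneg t) h3]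
  rw [div_le_iff₀ (by positivity)]
  calc c = c * (1 / t) * t := by field_simp
    _ ≤ t ^ 2 * moment s 2 t * t := by gcongr
    _ = _ := by ring

/-! ### The tilted characteristic function and its coefficients -/

/-- The characteristic function at `θ` of the size of a random `s`-regular partition, chosen with
probability proportional to `e^{-t n}`, where `n` is its size. -/
noncomputable def tiltedChar (s : ℕ) (t θ : ℝ) : ℂ :=
  Complex.exp (logGen s (t - θ * Complex.I) - logGen s t)

/-- The `n`-th Fourier coefficient, up to a factor `2 π`, of `tiltedChar s t`. -/
noncomputable def tiltedCoeff (s : ℕ) (t : ℝ) (n : ℕ) : ℂ :=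
  ∫ θ in (-Real.pi)..Real.pi, tiltedChar s t θ * Complex.exp (-(n * θ * Complex.I))

lemma summable_logGen_sub {t : ℝ} (ht : 0 < t) (s : ℕ) (θ : ℝ) :
    Summable fun p => (logWeight s p : ℂ) * Complex.exp (-(logExponent p * (t - θ * Complex.I))) :=
  summable_logGen (by simpa using ht) s

lemma summable_logGen_ofReal {t : ℝ} (ht : 0 < t) (s : ℕ) :
    Summable fun p => (logWeight s p : ℂ) * Complex.exp (-(logExponent p * (t : ℂ))) :=
  summable_logGen (by simpa using ht) s

lemma logGen_term_eq (s : ℕ) (t θ : ℝ) (p : ℕ × ℕ) :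
    (logWeight s p : ℂ) * Complex.exp (-(logExponent p * (t - θ * Complex.I))) =
      ((logWeight s p * Real.exp (-(logExponent p * t)) : ℝ) : ℂ) *
        Complex.exp (((logExponent p * θ : ℝ) : ℂ) * Complex.I) := by
  rw [Complex.ofReal_mul, mul_assoc, Complex.ofReal_exp, ← Complex.exp_add]
  congr 2
  push_cast
  ring

lemma logGen_term_ofReal_eq (s : ℕ) (t : ℝ) (p : ℕ × ℕ) :
    (logWeight s p : ℂ) * Complex.exp (-(logExponent p * (t : ℂ))) =
      ((logWeight s p * Real.exp (-(logExponent p * t)) : ℝ) : ℂ) := by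
  push_cast
  rfl

lemma norm_tiltedChar {t : ℝ} (ht : 0 < t) (s : ℕ) (θ : ℝ) :
    ‖tiltedChar s t θ‖ = Real.exp (-logGap s t θ) := by
  rw [tiltedChar, Complex.norm_exp]
  congr 1
  have h := Complex.hasSum_re
    ((summable_logGen_sub ht s θ).hasSum.sub (summable_logGen_ofReal ht s).hasSum)
  rw [logGap, ← tsum_neg, logGen, logGen, ← h.tsum_eq]
  refine tsum_congr fun p => ?_
  rw [logGen_term_eq, logGen_term_ofReal_eq, Complex.sub_re, Complex.re_ofReal_mul,
    Complex.exp_ofReal_mul_I_re, Complex.ofReal_re]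
  ring

lemma continuous_tiltedChar {t : ℝ} (ht : 0 < t) (s : ℕ) : Continuous (tiltedChar s t) := by
  have h : Continuous fun θ : ℝ => logGen s (t - θ * Complex.I) := by
    unfold logGen
    refine continuous_tsum (fun p => by fun_prop) (summable_logWeight_mul ht s 0) fun p θ => ?_
    rw [norm_logGen_term]
    simp
  unfold tiltedChar
  fun_prop

lemma continuous_tiltedChar_mul {t : ℝ} (ht : 0 < t) (s n : ℕ) :
    Continuous fun θ : ℝ => tiltedChar s t θ * Complex.exp (-(n * θ * Complex.I)) :=
  (continuous_tiltedChar ht s).mul (by fun_prop)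

lemma integral_exp_int_mul_I (m : ℤ) :
    ∫ θ in (-Real.pi)..Real.pi, Complex.exp (m * Complex.I * (θ : ℂ)) =
      if m = 0 then 2 * (Real.pi : ℂ) else 0 := by
  split_ifs with h
  · subst h
    simp
    ring
  · have hm : (m : ℂ) * Complex.I ≠ 0 :=
      mul_ne_zero (by exact_mod_cast h) Complex.I_ne_zero
    rw [integral_exp_mul_complex hm, div_eq_zero_iff]
    left
    rw [sub_eq_zero, Complex.exp_eq_exp_iff_exists_int]
    exact ⟨m, by push_cast; ring⟩

/-- Coefficient extraction. -/
lemma tiltedCoeff_eq {t : ℝ} (ht : 0 < t) (s n : ℕ) :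
    tiltedCoeff s t n = 2 * (Real.pi : ℂ) * (regularPartitionCount s n * Complex.exp (-t) ^ n) /
      Complex.exp (logGen s t) := by
  have hsum := summable_regularPartitionCount ht s
  have h := intervalIntegral.hasSum_integral_of_dominated_convergence
    (μ := MeasureTheory.volume) (a := -Real.pi) (b := Real.pi)
    (F := fun (k : ℕ) (θ : ℝ) => (regularPartitionCount s k * Complex.exp (-t) ^ k : ℂ) *
      Complex.exp (((k : ℤ) - (n : ℤ) : ℤ) * Complex.I * (θ : ℂ)))
    (f := fun θ => Complex.exp (logGen s t) *
      (tiltedChar s t θ * Complex.exp (-(n * θ * Complex.I))))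
    (fun k _ => (regularPartitionCount s k : ℝ) * Real.exp (-t) ^ k) (fun k => ?_) (fun k => ?_) ?_ ?_ ?_
  · have h2 : ∀ k : ℕ, ∫ θ in (-Real.pi)..Real.pi,
        (regularPartitionCount s k * Complex.exp (-t) ^ k : ℂ) *
          Complex.exp (((k : ℤ) - (n : ℤ) : ℤ) * Complex.I * (θ : ℂ)) =
        if k = n then 2 * (Real.pi : ℂ) * (regularPartitionCount s n * Complex.exp (-t) ^ n) else 0 := by
      intro k
      rw [intervalIntegral.integral_const_mul, integral_exp_int_mul_I]
      by_cases hk : k = n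
      · subst hk
        simp
        ring
      · have : (k : ℤ) - n ≠ 0 := by omega
        simp [this, hk]
    simp_rw [h2] at h
    have h3 := h.unique (hasSum_ite_eq n _)
    rw [intervalIntegral.integral_const_mul] at h3
    rw [eq_div_iff (Complex.exp_ne_zero _), mul_comm]
    exact h3
  · exact Continuous.aestronglyMeasurable (by fun_prop)
  · refine Eventually.of_forall fun θ _ => le_of_eq ?_
    rw [norm_mul, norm_mul, norm_pow, Complex.norm_natCast, Complex.norm_exp, Complex.norm_exp]
    simp
  · exact Eventually.of_forall fun θ _ => hsum
  · exact intervalIntegrable_const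
  · refine Eventually.of_forall fun θ _ => ?_
    have hz : 0 < ((t : ℂ) - θ * Complex.I).re := by simpa using ht
    have h1 := (hasSum_regularPartitionCount hz s).mul_right (Complex.exp (-(n * θ * Complex.I)))
    have h2 : Complex.exp (logGen s t) * (tiltedChar s t θ * Complex.exp (-(n * θ * Complex.I))) =
        Complex.exp (logGen s (t - θ * Complex.I)) * Complex.exp (-(n * θ * Complex.I)) := by
      rw [tiltedChar, ← mul_assoc, ← Complex.exp_add]
      congr 2
      ring
    rw [h2]
    refine h1.congr_of_eq fun k => ?_
    have h3 : Complex.exp (-t) ^ k * Complex.exp (((k : ℤ) - (n : ℤ) : ℤ) * Complex.I * (θ : ℂ)) =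
        Complex.exp (-(t - θ * Complex.I)) ^ k * Complex.exp (-(n * θ * Complex.I)) := by
      rw [← Complex.exp_nat_mul, ← Complex.exp_nat_mul, ← Complex.exp_add, ← Complex.exp_add]
      congr 1
      push_cast
      ring
    rw [mul_assoc, h3, ← mul_assoc]

/-! ### Local limit theorem at the saddle point -/

lemma norm_exp_mul_I_sub_taylor_le (x : ℝ) :
    ‖Complex.exp (x * Complex.I) - 1 - x * Complex.I + x ^ 2 / 2‖ ≤ 4 * |x| ^ 3 := by
  have hn : ‖(x : ℂ) * Complex.I‖ = |x| := by simp
  rcases le_or_gt |x| 1 with h | h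
  · have hb := Complex.exp_bound (x := x * Complex.I) (by rwa [hn]) (n := 3) (by norm_num)
    rw [hn] at hb
    have e : Complex.exp (x * Complex.I) - ∑ m ∈ Finset.range 3, (x * Complex.I) ^ m / m.factorial =
        Complex.exp (x * Complex.I) - 1 - x * Complex.I + x ^ 2 / 2 := by
      simp only [Finset.sum_range_succ, Finset.sum_range_zero, mul_pow, Complex.I_sq]
      simp
      ring
    rw [e] at hb
    refine hb.trans ?_
    have : 0 ≤ |x| ^ 3 := by positivity
    norm_num [Nat.factorial]
    linarith
  · have h1 : ‖Complex.exp (x * Complex.I) - 1 - x * Complex.I + x ^ 2 / 2‖ ≤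
        1 + 1 + |x| + |x| ^ 2 / 2 := by
      refine (norm_add_le _ _).trans ?_
      refine add_le_add ((norm_sub_le _ _).trans ?_) (le_of_eq ?_)
      · refine add_le_add ((norm_sub_le _ _).trans ?_) hn.le
        rw [Complex.norm_exp_ofReal_mul_I, norm_one]
      · simp
    refine h1.trans ?_
    nlinarith [mul_pos (sub_pos.2 h) (sub_pos.2 h), pow_pos (lt_trans one_pos h) 3]

/-- Second order expansion of `logGen` with a cubic remainder. -/
lemma norm_logGen_taylor_le {t : ℝ} (ht : 0 < t) (s : ℕ) (θ : ℝ) :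
    ‖logGen s (t - θ * Complex.I) - logGen s t - θ * moment s 1 t * Complex.I +
      θ ^ 2 / 2 * moment s 2 t‖ ≤ 4 * |θ| ^ 3 * moment s 3 t := by
  have h1 := (summable_logGen_sub ht s θ).hasSum
  have h2 := (summable_logGen_ofReal ht s).hasSum
  have h3 := (Complex.hasSum_ofReal.2 (summable_logWeight_mul ht s 1).hasSum).mul_left (θ * Complex.I)
  have h4 := (Complex.hasSum_ofReal.2 (summable_logWeight_mul ht s 2).hasSum).mul_left
    ((θ : ℂ) ^ 2 / 2)
  have h := ((h1.sub h2).sub h3).add h4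
  have e : logGen s (t - θ * Complex.I) - logGen s t - θ * moment s 1 t * Complex.I +
      θ ^ 2 / 2 * moment s 2 t = logGen s (t - θ * Complex.I) - logGen s t -
      θ * Complex.I * moment s 1 t + θ ^ 2 / 2 * moment s 2 t := by ring
  rw [e]
  change HasSum _ (logGen s (t - θ * Complex.I) - logGen s t -
      θ * Complex.I * moment s 1 t + θ ^ 2 / 2 * moment s 2 t) at h
  rw [← h.tsum_eq]
  have hb := ((summable_logWeight_mul ht s 3).mul_left (4 * |θ| ^ 3)).hasSum
  rw [tsum_mul_left] at hb
  refine tsum_of_norm_bounded hb fun p => ?_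
  rw [logGen_term_eq, logGen_term_ofReal_eq]
  have hx := norm_exp_mul_I_sub_taylor_le (logExponent p * θ)
  set w := logWeight s p * Real.exp (-(logExponent p * t)) with hw
  have hw0 : 0 ≤ w := mul_nonneg (logWeight_nonneg s p) (Real.exp_pos _).le
  calc _ = ‖(w : ℂ) * (Complex.exp (((logExponent p * θ : ℝ) : ℂ) * Complex.I) - 1 -
        ((logExponent p * θ : ℝ) : ℂ) * Complex.I + ((logExponent p * θ : ℝ) : ℂ) ^ 2 / 2)‖ := by
        congr 1
        rw [hw]
        push_cast
        ring
    _ ≤ w * (4 * |logExponent p * θ| ^ 3) := by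
        rw [norm_mul, Complex.norm_real, Real.norm_eq_abs, abs_of_nonneg hw0]
        gcongr
    _ = _ := by
        rw [hw, abs_mul, Nat.abs_cast]
        ring

/-- Cubic growth conditions are what both alternatives of `exists_le_logGap` have in common on the
range of integration. -/
lemma exp_neg_le_of_cube_ge {X v ε : ℝ} (hX : 0 ≤ X) (hε : 0 < ε) (h : 1 ≤ |v| → ε * v ^ 2 ≤ X ^ 3) :
    Real.exp (-X) ≤ 16 * (1 + 720 / ε ^ 2) * (1 + ‖v‖) ^ (-4 : ℝ) := by
  rw [Real.norm_eq_abs, Real.rpow_neg (by positivity), show (4 : ℝ) = ((4 : ℕ) : ℝ) by norm_num,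
    Real.rpow_natCast, ← div_eq_mul_inv, le_div_iff₀ (by positivity)]
  have h720 : 0 < 720 / ε ^ 2 := by positivity
  rcases le_or_gt 1 |v| with hv | hv
  · have h1 := h hv
    have h2 : ε ^ 2 * v ^ 4 ≤ X ^ 6 := by
      calc ε ^ 2 * v ^ 4 = (ε * v ^ 2) ^ 2 := by ring
        _ ≤ (X ^ 3) ^ 2 := by gcongr
        _ = X ^ 6 := by ring
    have h3 := Real.pow_div_factorial_le_exp X hX 6
    have h4 : (1 + |v|) ^ 4 ≤ 16 * v ^ 4 := by
      calc (1 + |v|) ^ 4 ≤ (2 * |v|) ^ 4 := by gcongr; linarith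
        _ = 16 * v ^ 4 := by rw [mul_pow, pow_abs, abs_of_nonneg (by positivity)]; norm_num
    have h5 : ε ^ 2 * v ^ 4 / 720 ≤ Real.exp X := by
      refine le_trans ?_ h3
      norm_num [Nat.factorial]
      linarith
    have h6 : v ^ 4 ≤ 720 / ε ^ 2 * Real.exp X := by
      rw [div_mul_eq_mul_div, le_div_iff₀ (by positivity)]
      linarith
    have h7 : Real.exp (-X) * Real.exp X = 1 := by rw [← Real.exp_add]; simp
    calc Real.exp (-X) * (1 + |v|) ^ 4 ≤ Real.exp (-X) * (16 * (720 / ε ^ 2 * Real.exp X)) := by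
          gcongr
          linarith
      _ = 16 * (720 / ε ^ 2) * (Real.exp (-X) * Real.exp X) := by ring
      _ ≤ _ := by rw [h7]; linarith
  · have h1 : Real.exp (-X) ≤ 1 := by simpa using hX
    have h2 : (1 + |v|) ^ 4 ≤ 2 ^ 4 := by gcongr; linarith
    calc Real.exp (-X) * (1 + |v|) ^ 4 ≤ 1 * 2 ^ 4 := by gcongr
      _ ≤ _ := by linarith

lemma logGap_nonneg (s : ℕ) (t θ : ℝ) : 0 ≤ logGap s t θ :=
  tsum_nonneg fun p => mul_nonneg (logWeight_nonneg s p)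
    (mul_nonneg (Real.exp_pos _).le (one_sub_cos_nonneg _))

/-- The standard deviation of the tilted measure. -/
noncomputable def tiltedStd (s : ℕ) (t : ℝ) : ℝ := √(moment s 2 t)

/-- In the standardised variable the characteristic function has an integrable majorant which does
not depend on `t`. -/
lemma exists_norm_tiltedChar_le {s : ℕ} (hs : 2 ≤ s) : ∃ K > 0, ∀ t v : ℝ, 0 < t → s * t ≤ 1 →
    |v| ≤ Real.pi * tiltedStd s t →
    ‖tiltedChar s t (v / tiltedStd s t)‖ ≤ K * (1 + ‖v‖) ^ (-4 : ℝ) := by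
  obtain ⟨c, hc, hgap⟩ := exists_le_logGap hs
  obtain ⟨c', hc', hlow⟩ := exists_le_moment_two hs
  obtain ⟨C, hC, hup⟩ := exists_moment_le 2
  set ε := min ((c / C) ^ 3) (c ^ 3 / (Real.pi ^ 2 * C)) with hε
  have hπ := Real.pi_pos
  have hε0 : 0 < ε := lt_min (by positivity) (by positivity)
  refine ⟨16 * (1 + 720 / ε ^ 2), by positivity, fun t v ht hst hv => ?_⟩
  have hM : 0 < moment s 2 t := lt_of_lt_of_le (by positivity) (hlow t ht hst)
  have hσ : 0 < tiltedStd s t := Real.sqrt_pos.2 hM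
  have hσ2 : tiltedStd s t ^ 2 = moment s 2 t := Real.sq_sqrt hM.le
  have hMC := hup s t ht
  rw [le_div_iff₀ (by positivity)] at hMC
  rw [norm_tiltedChar ht]
  refine exp_neg_le_of_cube_ge (logGap_nonneg _ _ _) hε0 fun hv1 => ?_
  have hv2 : 1 ≤ v ^ 2 := by rw [← sq_abs]; nlinarith
  have hθ : |v / tiltedStd s t| ≤ Real.pi := by
    rw [abs_div, abs_of_pos hσ, div_le_iff₀ hσ]
    exact hv
  rcases hgap t (v / tiltedStd s t) ht hst hθ with h | h
  · have h1 : c / C * v ^ 2 ≤ logGap s t (v / tiltedStd s t) := by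
      refine le_trans ?_ h
      rw [div_pow, hσ2, div_div, div_mul_eq_mul_div, mul_div_assoc]
      gcongr
    calc ε * v ^ 2 ≤ (c / C) ^ 3 * v ^ 2 := by gcongr; exact min_le_left _ _
      _ ≤ (c / C) ^ 3 * (v ^ 2) ^ 3 := by
        gcongr
        nlinarith [mul_nonneg (sub_nonneg.2 hv2) (sub_nonneg.2 hv2)]
      _ = (c / C * v ^ 2) ^ 3 := by ring
      _ ≤ _ := by gcongr
  · have h1 : v ^ 2 * t ^ 3 ≤ Real.pi ^ 2 * C := by
      have : v ^ 2 ≤ Real.pi ^ 2 * moment s 2 t := by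
        rw [← hσ2, ← mul_pow, ← sq_abs v]
        gcongr
      calc v ^ 2 * t ^ 3 ≤ Real.pi ^ 2 * moment s 2 t * t ^ 3 := by gcongr
        _ = Real.pi ^ 2 * (moment s 2 t * t ^ 3) := by ring
        _ ≤ _ := by gcongr
    calc ε * v ^ 2 ≤ c ^ 3 / (Real.pi ^ 2 * C) * v ^ 2 := by gcongr; exact min_le_right _ _
      _ ≤ (c * (1 / t)) ^ 3 := by
        rw [div_mul_eq_mul_div, div_le_iff₀ (by positivity), mul_one_div, div_pow,
          div_mul_eq_mul_div, le_div_iff₀ (by positivity)]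
        nlinarith [pow_pos hc 3]
      _ ≤ _ := by gcongr

lemma exists_div_cube_le_tiltedStd_sq {s : ℕ} (hs : 2 ≤ s) :
    ∃ c > 0, ∀ t : ℝ, 0 < t → s * t ≤ 1 → c / t ^ 3 ≤ tiltedStd s t ^ 2 ∧ 0 < tiltedStd s t := by
  obtain ⟨c, hc, h⟩ := exists_le_moment_two hs
  refine ⟨c, hc, fun t ht hst => ?_⟩
  have h1 := h t ht hst
  have hM : 0 < moment s 2 t := lt_of_lt_of_le (by positivity) h1
  exact ⟨by rwa [tiltedStd, Real.sq_sqrt hM.le], Real.sqrt_pos.2 hM⟩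

lemma eventually_mul_le_one {t : ℕ → ℝ} (ht0 : Tendsto t atTop (𝓝 0)) (s : ℝ) :
    ∀ᶠ n in atTop, s * t n ≤ 1 := by
  have : Tendsto (fun n => s * t n) atTop (𝓝 (s * 0)) := ht0.const_mul _
  rw [mul_zero] at this
  exact (this.eventually (gt_mem_nhds one_pos)).mono fun _ h => h.le

/-- In the standardised variable the centred characteristic function tends to the Gaussian. -/
lemma tendsto_tiltedChar_mul_exp {s : ℕ} (hs : 2 ≤ s) {t : ℕ → ℝ} (ht : ∀ᶠ n in atTop, 0 < t n)
    (ht0 : Tendsto t atTop (𝓝 0)) (hmean : ∀ᶠ n in atTop, moment s 1 (t n) = n) (v : ℝ) :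
    Tendsto (fun n : ℕ => tiltedChar s (t n) (v / tiltedStd s (t n)) *
      Complex.exp (-(n * (v / tiltedStd s (t n) : ℝ) * Complex.I))) atTop
      (𝓝 (Real.exp (-(1 / 2) * v ^ 2) : ℝ)) := by
  obtain ⟨c, hc, hlow⟩ := exists_div_cube_le_tiltedStd_sq hs
  obtain ⟨C, hC, hup⟩ := exists_moment_le 3
  have hst := eventually_mul_le_one ht0 s
  set E : ℕ → ℂ := fun n => logGen s (t n - (v / tiltedStd s (t n) : ℝ) * Complex.I) -
    logGen s (t n) - n * (v / tiltedStd s (t n) : ℝ) * Complex.I with hE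
  have hbound : Tendsto (fun n => 4 * |v| ^ 3 * √(C ^ 2 / c ^ 3 * t n)) atTop (𝓝 0) := by
    have h1 : Tendsto (fun n => C ^ 2 / c ^ 3 * t n) atTop (𝓝 (C ^ 2 / c ^ 3 * 0)) :=
      ht0.const_mul _
    have h2 := ((Real.continuous_sqrt.tendsto _).comp h1).const_mul (4 * |v| ^ 3)
    simpa using h2
  have hE0 : Tendsto (fun n => E n + (v ^ 2 / 2 : ℝ)) atTop (𝓝 0) := by
    refine squeeze_zero_norm' ?_ hbound
    filter_upwards [ht, hmean, hst] with n h1 h2 h3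
    obtain ⟨h4, hσ⟩ := hlow (t n) h1 h3
    have hM0 := moment_nonneg s 2 (t n)
    have hσ2 : tiltedStd s (t n) ^ 2 = moment s 2 (t n) := Real.sq_sqrt hM0
    have h5 := norm_logGen_taylor_le h1 s (v / tiltedStd s (t n))
    have e : logGen s (t n - (v / tiltedStd s (t n) : ℝ) * Complex.I) - logGen s (t n) -
        (v / tiltedStd s (t n) : ℝ) * moment s 1 (t n) * Complex.I +
        ((v / tiltedStd s (t n) : ℝ) : ℂ) ^ 2 / 2 * moment s 2 (t n) = E n + (v ^ 2 / 2 : ℝ) := by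
      have : (v / tiltedStd s (t n)) ^ 2 / 2 * moment s 2 (t n) = v ^ 2 / 2 := by
        rw [← hσ2]; field_simp
      rw [← this, hE, h2]
      push_cast
      ring
    rw [e] at h5
    refine h5.trans ?_
    rw [abs_div, abs_of_pos hσ, div_pow, mul_div_assoc', div_mul_eq_mul_div, mul_div_assoc]
    refine mul_le_mul_of_nonneg_left ?_ (by positivity)
    -- third moment over the cube of the deviation is of order `√t`
    refine (le_abs_self _).trans (Real.abs_le_sqrt ?_)
    have h6 := hup s (t n) h1
    have h7 := moment_nonneg s 3 (t n)
    rw [div_pow, div_le_iff₀ (by positivity)]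
    calc moment s 3 (t n) ^ 2 ≤ (C / t n ^ (3 + 1)) ^ 2 := by gcongr
      _ = C ^ 2 / c ^ 3 * t n * (c / t n ^ 3) ^ 3 := by field_simp; ring
      _ ≤ C ^ 2 / c ^ 3 * t n * (tiltedStd s (t n) ^ 2) ^ 3 := by gcongr
      _ = _ := by ring
  have h := (Complex.continuous_exp.tendsto _).comp (hE0.sub_const (((v ^ 2 / 2 : ℝ)) : ℂ))
  have e2 : Complex.exp (0 - ((v ^ 2 / 2 : ℝ) : ℂ)) = ((Real.exp (-(1 / 2) * v ^ 2) : ℝ) : ℂ) := by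
    rw [Complex.ofReal_exp]
    congr 1
    push_cast
    ring
  rw [e2] at h
  refine h.congr fun n => ?_
  simp only [Function.comp, hE, tiltedChar]
  rw [← Complex.exp_add]
  congr 1
  ring

lemma integrable_majorant {r : ℝ} (hr : 1 < r) :
    MeasureTheory.Integrable (fun v : ℝ => (1 + ‖v‖) ^ (-r)) := by
  refine integrable_one_add_norm ?_
  simpa using hr

/-- Passage to the standardised variable `v = θ σ`. -/
lemma integral_pi_eq {E : Type*} [NormedAddCommGroup E] [NormedSpace ℝ E] (f : ℝ → E) {σ : ℝ}
    (hσ : 0 < σ) : σ • ∫ θ in (-Real.pi)..Real.pi, f θ =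
      ∫ v, (Set.Ioc (-Real.pi * σ) (Real.pi * σ)).indicator (fun v => f (v / σ)) v := by
  have h := intervalIntegral.integral_comp_div (a := -Real.pi * σ) (b := Real.pi * σ) f hσ.ne'
  rw [mul_div_cancel_right₀ _ hσ.ne', mul_div_cancel_right₀ _ hσ.ne'] at h
  have hle : -Real.pi * σ ≤ Real.pi * σ := by
    have := mul_pos Real.pi_pos hσ
    linarith
  rw [← h, intervalIntegral.integral_of_le hle, MeasureTheory.integral_indicator measurableSet_Ioc]

/-- The local limit theorem at the mean, by dominated convergence in the standardised variable. -/
theorem tendsto_tiltedStd_mul_tiltedCoeff {s : ℕ} (hs : 2 ≤ s) {t : ℕ → ℝ}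
    (ht : ∀ᶠ n in atTop, 0 < t n) (ht0 : Tendsto t atTop (𝓝 0))
    (hmean : ∀ᶠ n in atTop, moment s 1 (t n) = n) :
    Tendsto (fun n : ℕ => tiltedStd s (t n) • tiltedCoeff s (t n) n) atTop
      (𝓝 ((√(2 * Real.pi) : ℝ) : ℂ)) := by
  obtain ⟨c, hc, hlow⟩ := exists_div_cube_le_tiltedStd_sq hs
  obtain ⟨K, hK, hmaj⟩ := exists_norm_tiltedChar_le hs
  have hst := eventually_mul_le_one ht0 s
  have hσ_top : Tendsto (fun n => tiltedStd s (t n)) atTop atTop := by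
    have h1 : Tendsto (fun n => c * (t n)⁻¹) atTop atTop := by
      refine Tendsto.const_mul_atTop hc (tendsto_inv_nhdsGT_zero.comp
        (tendsto_nhdsWithin_iff.2 ⟨ht0, ht⟩))
    have h2 := Real.tendsto_sqrt_atTop.comp h1
    refine tendsto_atTop_mono' atTop ?_ h2
    filter_upwards [ht, hst] with n h3 h4
    obtain ⟨h5, h6⟩ := hlow (t n) h3 h4
    refine Real.sqrt_le_iff.2 ⟨h6.le, le_trans ?_ h5⟩
    have hs2 : (2 : ℝ) ≤ s := by exact_mod_cast hs
    have h7 : t n ≤ 1 := by nlinarith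
    change c * (t n)⁻¹ ≤ _
    rw [← div_eq_mul_inv]
    have h8 : t n ^ 3 ≤ t n := by
      have := pow_le_pow_of_le_one h3.le h7 (show 1 ≤ 3 by norm_num)
      rwa [pow_one] at this
    gcongr
  have hgauss : ((√(2 * Real.pi) : ℝ) : ℂ) = ∫ v : ℝ, ((Real.exp (-(1 / 2) * v ^ 2) : ℝ) : ℂ) := by
    have h1 := integral_gaussian (1 / 2)
    rw [show Real.pi / (1 / 2) = 2 * Real.pi by ring] at h1
    rw [← h1]
    exact integral_ofReal.symm
  rw [hgauss]
  have h := MeasureTheory.tendsto_integral_filter_of_dominated_convergence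
    (μ := MeasureTheory.volume) (l := atTop)
    (F := fun (n : ℕ) (v : ℝ) => (Set.Ioc (-Real.pi * tiltedStd s (t n))
      (Real.pi * tiltedStd s (t n))).indicator (fun v => tiltedChar s (t n) (v / tiltedStd s (t n)) *
        Complex.exp (-(n * (v / tiltedStd s (t n) : ℝ) * Complex.I))) v)
    (f := fun v : ℝ => ((Real.exp (-(1 / 2) * v ^ 2) : ℝ) : ℂ))
    (fun v => K * (1 + ‖v‖) ^ (-4 : ℝ)) ?_ ?_ ((integrable_majorant (by norm_num)).const_mul K) ?_
  · refine h.congr' ?_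
    filter_upwards [ht, hst] with n h1 h2
    rw [tiltedCoeff, integral_pi_eq _ (hlow (t n) h1 h2).2]
  · filter_upwards [ht] with n h1
    refine (Continuous.aestronglyMeasurable ?_).indicator measurableSet_Ioc
    exact (continuous_tiltedChar_mul h1 s n).comp (continuous_id.div_const _)
  · filter_upwards [ht, hst] with n h1 h2
    refine Eventually.of_forall fun v => ?_
    by_cases hv : v ∈ Set.Ioc (-Real.pi * tiltedStd s (t n)) (Real.pi * tiltedStd s (t n))
    · rw [Set.indicator_of_mem hv, norm_mul, Complex.norm_exp]
      have : (-(n * (v / tiltedStd s (t n) : ℝ) * Complex.I)).re = 0 := by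
        rw [Complex.neg_re, ← Complex.ofReal_natCast, ← Complex.ofReal_mul, Complex.re_ofReal_mul]
        simp
      rw [this, Real.exp_zero, mul_one]
      exact hmaj (t n) v h1 h2 (abs_le.2 ⟨by linarith [hv.1], hv.2⟩)
    · rw [Set.indicator_of_notMem hv, norm_zero]
      positivity
  · refine Eventually.of_forall fun v => ?_
    refine (tendsto_tiltedChar_mul_exp hs ht ht0 hmean v).congr' ?_
    filter_upwards [hσ_top.eventually_gt_atTop |v|] with n hn
    rw [Set.indicator_of_mem]
    have h1 : |v| ≤ Real.pi * tiltedStd s (t n) := by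
      nlinarith [Real.pi_gt_three, abs_nonneg v]
    have h2 : |v| < Real.pi * tiltedStd s (t n) := by
      nlinarith [Real.pi_gt_three, abs_nonneg v]
    exact ⟨by linarith [(abs_lt.1 h2).1], (abs_lt.1 h2).2.le⟩

/-- Consecutive coefficients differ by `O(σ⁻²)`, while by the local limit theorem the coefficients
near the mean are of order `σ⁻¹`, where `σ` is the standard deviation. -/
lemma exists_norm_tiltedCoeff_succ_sub_le {s : ℕ} (hs : 2 ≤ s) : ∃ K > 0, ∀ (t : ℝ) (n : ℕ), 0 < t →
    s * t ≤ 1 → tiltedStd s t ^ 2 * ‖tiltedCoeff s t (n + 1) - tiltedCoeff s t n‖ ≤ K := by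
  obtain ⟨c, hc, hlow⟩ := exists_div_cube_le_tiltedStd_sq hs
  obtain ⟨K, hK, hmaj⟩ := exists_norm_tiltedChar_le hs
  set J := ∫ v : ℝ, (1 + ‖v‖) ^ (-3 : ℝ) with hJ
  have hJ0 : 0 ≤ J := MeasureTheory.integral_nonneg fun v => by positivity
  refine ⟨K * J + 1, by positivity, fun t n ht hst => ?_⟩
  have hσ := (hlow t ht hst).2
  set σ := tiltedStd s t with hσ_def
  have h1 : tiltedCoeff s t (n + 1) - tiltedCoeff s t n =
      ∫ θ in (-Real.pi)..Real.pi, tiltedChar s t θ * Complex.exp (-(n * θ * Complex.I)) *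
        (Complex.exp (Complex.I * ((-θ : ℝ) : ℂ)) - 1) := by
    rw [tiltedCoeff, tiltedCoeff, ← intervalIntegral.integral_sub
      ((continuous_tiltedChar_mul ht s _).intervalIntegrable _ _)
      ((continuous_tiltedChar_mul ht s _).intervalIntegrable _ _)]
    congr 1
    ext θ
    rw [mul_sub, mul_one, mul_assoc (tiltedChar s t θ) _ (Complex.exp (Complex.I * _)),
      ← Complex.exp_add]
    congr 3
    push_cast
    ring
  have h2 : ‖tiltedCoeff s t (n + 1) - tiltedCoeff s t n‖ ≤
      ∫ θ in (-Real.pi)..Real.pi, ‖tiltedChar s t θ‖ * |θ| := by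
    rw [h1]
    refine intervalIntegral.norm_integral_le_of_norm_le (by linarith [Real.pi_pos])
      (Eventually.of_forall fun θ _ => ?_)
      (((continuous_tiltedChar ht s).norm.mul continuous_abs).intervalIntegrable _ _)
    rw [norm_mul, norm_mul, Complex.norm_exp]
    have : (-(n * θ * Complex.I) : ℂ).re = 0 := by
      rw [Complex.neg_re, ← Complex.ofReal_natCast, ← Complex.ofReal_mul, Complex.re_ofReal_mul]
      simp
    rw [this, Real.exp_zero, mul_one]
    gcongr
    refine Real.norm_exp_I_mul_ofReal_sub_one_le.trans (le_of_eq ?_)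
    rw [Real.norm_eq_abs, abs_neg]
  have h3 := integral_pi_eq (fun θ => ‖tiltedChar s t θ‖ * |θ|) hσ
  rw [smul_eq_mul] at h3
  have h4 : ∫ v, (Set.Ioc (-Real.pi * σ) (Real.pi * σ)).indicator
      (fun v => ‖tiltedChar s t (v / σ)‖ * |v / σ|) v ≤ ∫ v : ℝ, K / σ * (1 + ‖v‖) ^ (-3 : ℝ) := by
    refine MeasureTheory.integral_mono_of_nonneg (Eventually.of_forall fun v => ?_)
      ((integrable_majorant (by norm_num)).const_mul _) (Eventually.of_forall fun v => ?_)
    · exact Set.indicator_nonneg (fun _ _ => by positivity) v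
    · by_cases hv : v ∈ Set.Ioc (-Real.pi * σ) (Real.pi * σ)
      · simp only [Set.indicator_of_mem hv]
        have h5 := hmaj t v ht hst (abs_le.2 ⟨by linarith [hv.1], hv.2⟩)
        rw [abs_div, abs_of_pos hσ]
        calc ‖tiltedChar s t (v / σ)‖ * (|v| / σ)
            ≤ K * (1 + ‖v‖) ^ (-4 : ℝ) * ((1 + ‖v‖) / σ) := by
              gcongr
              rw [Real.norm_eq_abs]
              linarith
          _ = K / σ * ((1 + ‖v‖) ^ (-4 : ℝ) * (1 + ‖v‖) ^ (1 : ℝ)) := by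
              rw [Real.rpow_one]; ring
          _ = _ := by
              rw [← Real.rpow_add (by positivity)]
              norm_num
      · simp only [Set.indicator_of_notMem hv]
        positivity
  rw [MeasureTheory.integral_const_mul] at h4
  have h5 : σ * ‖tiltedCoeff s t (n + 1) - tiltedCoeff s t n‖ ≤ K / σ * J :=
    (mul_le_mul_of_nonneg_left h2 hσ.le).trans (h3.le.trans h4)
  calc σ ^ 2 * ‖tiltedCoeff s t (n + 1) - tiltedCoeff s t n‖
      = σ * (σ * ‖tiltedCoeff s t (n + 1) - tiltedCoeff s t n‖) := by ring
    _ ≤ σ * (K / σ * J) := by gcongr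
    _ = K * J := by field_simp
    _ ≤ _ := by linarith

/-! ### Increments of the logarithm -/

/-- The saddle points: parameters `t n` at which the tilted measure has mean `n`. -/
lemma exists_saddle_sequence {s : ℕ} (hs : 2 ≤ s) : ∃ t : ℕ → ℝ, (∀ᶠ n in atTop, 0 < t n) ∧
    Tendsto t atTop (𝓝 0) ∧ (∀ᶠ n in atTop, moment s 1 (t n) = n) ∧
    Tendsto (fun n : ℕ => √n * t n) atTop (𝓝 √(meanConst s)) := by
  have hex : ∀ n : ℕ, ∃ t, 0 < n → 0 < t ∧ moment s 1 t = n := by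
    intro n
    by_cases hn : 0 < n
    · obtain ⟨t, h1, h2⟩ := exists_moment_one_eq hs (y := n) (by exact_mod_cast hn)
      exact ⟨t, fun _ => ⟨h1, h2⟩⟩
    · exact ⟨0, fun h => absurd h hn⟩
  choose t ht using hex
  have hpos : ∀ᶠ n in atTop, 0 < t n := by
    filter_upwards [eventually_gt_atTop 0] with n hn
    exact (ht n hn).1
  have hmean : ∀ᶠ n in atTop, moment s 1 (t n) = n := by
    filter_upwards [eventually_gt_atTop 0] with n hn
    exact (ht n hn).2
  have hsq0 : Tendsto t atTop (𝓝 0) := by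
    obtain ⟨C, hC, hup⟩ := exists_moment_le 1
    have h1 : Tendsto (fun n : ℕ => √(C * (n : ℝ)⁻¹)) atTop (𝓝 0) := by
      have h2 : Tendsto (fun n : ℕ => C * (n : ℝ)⁻¹) atTop (𝓝 (C * 0)) :=
        tendsto_inv_atTop_nhds_zero_nat.const_mul C
      have h3 := (Real.continuous_sqrt.tendsto _).comp h2
      rw [mul_zero, Real.sqrt_zero] at h3
      exact h3
    refine squeeze_zero_norm' ?_ h1
    filter_upwards [eventually_gt_atTop 0] with n hn
    obtain ⟨h2, h3⟩ := ht n hn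
    have hn' : (0 : ℝ) < n := by exact_mod_cast hn
    rw [Real.norm_eq_abs]
    refine Real.abs_le_sqrt ?_
    have h4 := hup s (t n) h2
    rw [h3, le_div_iff₀ (by positivity)] at h4
    rw [← div_eq_mul_inv, le_div_iff₀ hn', mul_comm]
    exact h4
  refine ⟨t, hpos, hsq0, hmean, ?_⟩
  have h1 := (tendsto_sq_mul_moment_one (by omega : 0 < s)).comp
    (tendsto_nhdsWithin_iff.2 ⟨hsq0, hpos⟩)
  have h2 := (Real.continuous_sqrt.tendsto _).comp h1
  refine h2.congr' ?_
  filter_upwards [hpos, hmean] with n h3 h4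
  simp only [Function.comp]
  rw [h4, Real.sqrt_mul (sq_nonneg _), Real.sqrt_sq h3.le, mul_comm]

lemma abs_log_le_two_mul {r : ℝ} (hr : |r - 1| ≤ 1 / 2) : |Real.log r| ≤ 2 * |r - 1| := by
  have h0 : 1 / 2 ≤ r := by linarith [(abs_le.1 hr).1]
  have h1 := Real.log_le_sub_one_of_pos (by linarith : 0 < r)
  have h2 := Real.one_sub_inv_le_log_of_pos (by linarith : 0 < r)
  have h3 : 1 - r⁻¹ = (r - 1) / r := by field_simp
  have h4 : |(r - 1) / r| ≤ 2 * |r - 1| := by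
    rw [abs_div, abs_of_pos (by linarith : 0 < r), div_le_iff₀ (by linarith)]
    nlinarith [abs_nonneg (r - 1)]
  rw [abs_le]
  constructor
  · linarith [(abs_le.1 h4).1]
  · linarith [le_abs_self (r - 1), abs_nonneg (r - 1)]

/-- The increments of `log b_s(n)` are asymptotic to the saddle point, hence to a multiple of
`1 / √n`. -/
theorem tendsto_sqrt_mul_log_regularPartitionCount {s : ℕ} (hs : 2 ≤ s) :
    Tendsto (fun n : ℕ => √n * (Real.log (regularPartitionCount s (n + 1)) -
      Real.log (regularPartitionCount s n))) atTop (𝓝 √(meanConst s)) := by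
  obtain ⟨t, ht, ht0, hmean, hsqrt⟩ := exists_saddle_sequence hs
  obtain ⟨c, hc, hlow⟩ := exists_div_cube_le_tiltedStd_sq hs
  obtain ⟨K, hK, hdiff⟩ := exists_norm_tiltedCoeff_succ_sub_le hs
  have hst := eventually_mul_le_one ht0 s
  -- `r n` is the ratio of consecutive coefficients at the saddle point of `n`
  set r : ℕ → ℝ := fun n => regularPartitionCount s (n + 1) / regularPartitionCount s n *
    Real.exp (-t n) with hr
  -- any constant below `√(2 π)` would do
  have hcoef : ∀ᶠ n in atTop, 1 < ‖tiltedStd s (t n) • tiltedCoeff s (t n) n‖ := by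
    refine (tendsto_tiltedStd_mul_tiltedCoeff hs ht ht0 hmean).norm.eventually (lt_mem_nhds ?_)
    rw [Complex.norm_real, Real.norm_eq_abs, abs_of_nonneg (Real.sqrt_nonneg _), Real.lt_sqrt one_pos.le]
    linarith [Real.pi_gt_three]
  have hmain : ∀ᶠ n in atTop, 0 < regularPartitionCount s n ∧ 0 < r n ∧
      |r n - 1| ≤ K / √c * (√(t n) * t n) := by
    have hsmall : ∀ᶠ n in atTop, K / √c * (√(t n) * t n) < 1 := by
      have h1 : Tendsto (fun n => K / √c * (√(t n) * t n)) atTop (𝓝 (K / √c * (√0 * 0))) :=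
        (((Real.continuous_sqrt.tendsto _).comp ht0).mul ht0).const_mul _
      rw [mul_zero, mul_zero] at h1
      exact h1.eventually (gt_mem_nhds one_pos)
    filter_upwards [ht, hst, hcoef, hsmall] with n h1 h2 h3 h4
    obtain ⟨h5, hσ⟩ := hlow (t n) h1 h2
    set σ := tiltedStd s (t n)
    rw [norm_smul, Real.norm_eq_abs, abs_of_pos hσ] at h3
    have hA : tiltedCoeff s (t n) n ≠ 0 := by
      intro h
      rw [h, norm_zero, mul_zero] at h3
      linarith
    have hb : 0 < regularPartitionCount s n := by
      rcases Nat.eq_zero_or_pos (regularPartitionCount s n) with h | h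
      · rw [tiltedCoeff_eq h1, h] at hA
        simp at hA
      · exact h
    have hquot : tiltedCoeff s (t n) (n + 1) = r n * tiltedCoeff s (t n) n := by
      have hb' : (regularPartitionCount s n : ℂ) ≠ 0 := by exact_mod_cast hb.ne'
      have hE := Complex.exp_ne_zero (logGen s (t n))
      rw [tiltedCoeff_eq h1, tiltedCoeff_eq h1, hr]
      push_cast
      rw [pow_succ]
      field_simp
    have hrn : |r n - 1| ≤ K / σ := by
      have h6 := hdiff (t n) n h1 h2
      have h7 : tiltedCoeff s (t n) (n + 1) - tiltedCoeff s (t n) n =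
          ((r n - 1 : ℝ) : ℂ) * tiltedCoeff s (t n) n := by
        rw [hquot]; push_cast; ring
      rw [h7, norm_mul, Complex.norm_real, Real.norm_eq_abs] at h6
      rw [le_div_iff₀ hσ]
      calc |r n - 1| * σ ≤ |r n - 1| * σ * (σ * ‖tiltedCoeff s (t n) n‖) :=
            le_mul_of_one_le_right (by positivity) h3.le
        _ = σ ^ 2 * (|r n - 1| * ‖tiltedCoeff s (t n) n‖) := by ring
        _ ≤ K := h6
    have hσlow : √c ≤ σ * (√(t n) * t n) := by
      refine Real.sqrt_le_iff.2 ⟨by positivity, ?_⟩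
      rw [mul_pow, mul_pow, Real.sq_sqrt h1.le]
      rw [div_le_iff₀ (by positivity)] at h5
      calc c ≤ σ ^ 2 * t n ^ 3 := h5
        _ = _ := by ring
    have hrn' : |r n - 1| ≤ K / √c * (√(t n) * t n) := by
      refine hrn.trans ?_
      have hc' : 0 < √c := Real.sqrt_pos.2 hc
      rw [div_mul_eq_mul_div, div_le_div_iff₀ hσ hc']
      nlinarith
    exact ⟨hb, by linarith [(abs_lt.1 (hrn'.trans_lt h4)).1], hrn'⟩
  have hrate : Tendsto (fun n : ℕ => 2 * (K / √c * (√(t n) * (√n * t n)))) atTop (𝓝 0) := by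
    have := ((((Real.continuous_sqrt.tendsto _).comp ht0).mul hsqrt).const_mul (K / √c)).const_mul 2
    simpa using this
  have hlogr : Tendsto (fun n : ℕ => √n * Real.log (r n)) atTop (𝓝 0) := by
    have hsmall : ∀ᶠ n in atTop, K / √c * (√(t n) * t n) < 1 / 2 := by
      have h1 : Tendsto (fun n => K / √c * (√(t n) * t n)) atTop (𝓝 (K / √c * (√0 * 0))) :=
        (((Real.continuous_sqrt.tendsto _).comp ht0).mul ht0).const_mul _
      rw [mul_zero, mul_zero] at h1
      exact h1.eventually (gt_mem_nhds (by norm_num))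
    refine squeeze_zero_norm' ?_ hrate
    filter_upwards [hmain, hsmall] with n h1 h2
    have h3 := abs_log_le_two_mul (h1.2.2.trans h2.le)
    rw [Real.norm_eq_abs, abs_mul, abs_of_nonneg (Real.sqrt_nonneg _)]
    calc √(n : ℝ) * |Real.log (r n)| ≤ √n * (2 * (K / √c * (√(t n) * t n))) := by
          gcongr
          exact h3.trans (mul_le_mul_of_nonneg_left h1.2.2 zero_le_two)
      _ = _ := by ring
  have := hsqrt.add hlogr
  rw [add_zero] at this
  refine this.congr' ?_
  filter_upwards [hmain] with n h1
  obtain ⟨hb, hrpos, -⟩ := h1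
  have hb' : (0 : ℝ) < regularPartitionCount s n := by exact_mod_cast hb
  have hb1 : (0 : ℝ) < regularPartitionCount s (n + 1) := by
    by_contra h
    have h0 : (regularPartitionCount s (n + 1) : ℝ) = 0 :=
      le_antisymm (not_lt.1 h) (Nat.cast_nonneg _)
    simp [hr, h0] at hrpos
  simp only [hr]
  rw [Real.log_mul (div_ne_zero hb1.ne' hb'.ne') (Real.exp_ne_zero _), Real.log_div hb1.ne' hb'.ne',
    Real.log_exp]
  ring

theorem corollary1p4 (s : ℕ) (hs : 2 ≤ s) :
    IsBenford (fun n => regularPartitionCount s n) :=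
  isBenford_of_sqrt_mul_log_increment (Real.sqrt_pos.2 (meanConst_pos hs))
    (tendsto_sqrt_mul_log_regularPartitionCount hs)
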